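/- Fix a set $C$ of colours. A hypergraph $H$ is a finite vertex set $V(H)$ (possibly empty) with a finite set of directed coloured edges $(v_1,\dots,v_r;c)$, where $r\ge 2$, the $v_i\in V(H)$ are distinct and $c\in C$; there are no loops and no multiple edges. (Here "multiple edges" may mean equal edges, or edges on the same ordered tuple, or edges on the same vertex set; fix any one of these three conventions. The theorem is asserted for each of them.) Isomorphisms preserve directions and colours. $H[U]$ denotes the subhypergraph induced by $U\subseteq V(H)$, whose edges are the edges of $H$ with all vertices in $U$. A property is a non-empty isomorphism-closed class of hypergraphs; it is induced-hereditary if it is closed under induced subhypergraphs, and additive if it is closed under disjoint unions. For properties $\mathcal P_1,\dots,\mathcal P_n$, the product $\mathcal P_1\circ\cdots\circ\mathcal P_n$ is the class of hypergraphs $H$ whose vertex set has a partition $(V_1,\dots,V_n)$, empty parts allowed, with $H[V_i]\in\mathcal P_i$ for all $i$ (the empty product consists of the null hypergraph). For hypergraphs $G_1,\dots,G_n$ with disjoint vertex sets, $G_1*\cdots*G_n$ is the set of all hypergraphs $H$ with $V(H)=\bigcup_i V(G_i)$ and $H[V(G_i)]=G_i$ for all $i$ (if the vertex sets are not disjoint,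 disjoint copies are taken). $kG$ is the disjoint union of $k$ copies of $G$, and $K_1$ is the one-vertex hypergraph without edges. Let $\mathcal P$ be a property. A $\mathcal P$-decomposition of $G$ with $n$ parts is a partition $(V_1,\dots,V_n)$ of $V(G)$ into non-empty sets such that $kG[V_1]*\cdots*kG[V_n]\subseteq\mathcal P$ for all integers $k\ge1$. For $G\in\mathcal P$, $dec_{\mathcal P}(G)$ is the maximum number of parts in a $\mathcal P$-decomposition of $G$ (so it is $0$ for the null hypergraph, whose only partition into non-empty parts is the empty one); for $G\notin\mathcal P$, $dec_{\mathcal P}(G)=0$. A hypergraph $G$ is $\mathcal P$-strict if $G\in\mathcal P$ and $G*K_1\not\subseteq\mathcal P$. The decomposability number $dec(\mathcal P)$ is the minimum of $dec_{\mathcal P}(G)$ over all $\mathcal P$-strict $G$ (and $\infty$ if there is no $\mathcal P$-strict $G$). $\mathcal P$ is indecomposable if $dec(\mathcal P)=1$. **Theorem.** Let $m\ge 0$ and let $\mathcal P=\mathcal Q_1\circ\cdots\circ\mathcal Q_m$ be a factorisation of an additive induced-hereditary property $\mathcal P$ into indecomposable additive induced-hereditary properties $\mathcal Q_1,\dots,\mathcal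 Q_m$. Then $m=dec(\mathcal P)$. -/

import Mathlib

/-- An edge `(v₁, …, vᵣ; c)`: the ordered list of its vertices together with its colour. -/
abbrev HEdge (C : Type*) (V : Type) := List V × C

/-- The image of an edge under a map of vertices. -/
def HEdge.map {C : Type*} {V W : Type} (f : V → W) (e : HEdge C V) : HEdge C W :=
  (List.map f e.1, e.2)

/-- The possible meanings of "multiple edges" for directed coloured edges: equal edges (so that
a set of edges never contains multiple edges), edges on the same ordered tuple (but possibly of
different colours), or edges on the same set of vertices. -/
inductive MultiRule where
  | sameEdge
  | sameTuple
  | sameVertices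

/-- `e` and `f` are parallel for the given meaning of "multiple edges". -/
def MultiRule.Parallel {C : Type*} {V : Type} (κ : MultiRule) (e f : HEdge C V) : Prop :=
  match κ with
  | .sameEdge => e = f
  | .sameTuple => e.1 = f.1
  | .sameVertices => ∀ v, v ∈ e.1 ↔ v ∈ f.1

/-- A finite directed hypergraph with edges coloured from `C`, without loops (each edge has at
least two vertices) and without multiple edges (in the sense of `κ`). The vertex set may be
empty. -/
structure DirHypergraph (κ : MultiRule) (C : Type*) where
  V : Type
  edges : Set (HEdge C V)
  finite_vertices : Finite V
  finite_edges : edges.Finite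
  nodup : ∀ e ∈ edges, e.1.Nodup
  two_le : ∀ e ∈ edges, 2 ≤ e.1.length
  simple : ∀ e ∈ edges, ∀ f ∈ edges, κ.Parallel e f → e = f

theorem HEdge.map_injective {C : Type*} {V W : Type} {f : V → W} (hf : Function.Injective f) :
    Function.Injective (HEdge.map (C := C) f) := by
  rintro ⟨l, c⟩ ⟨l', c'⟩ h
  simp only [HEdge.map, Prod.mk.injEq] at h
  exact Prod.ext (List.map_injective_iff.2 hf h.1) h.2

theorem MultiRule.parallel_map_iff {C : Type*} {V W : Type} (κ : MultiRule) {f : V → W}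
    (hf : Function.Injective f) (e e' : HEdge C V) :
    κ.Parallel (e.map f) (e'.map f) ↔ κ.Parallel e e' := by
  cases κ with
  | sameEdge => exact (HEdge.map_injective hf).eq_iff
  | sameTuple => exact (List.map_injective_iff.2 hf).eq_iff
  | sameVertices =>
    constructor
    · intro h v
      have := h (f v)
      simpa only [HEdge.map, List.mem_map_of_injective hf] using this
    · intro h w
      simp only [HEdge.map, List.mem_map]
      exact exists_congr fun v => and_congr_left fun _ => h v

theorem MultiRule.Parallel.mem_iff {C : Type*} {V : Type} {κ : MultiRule} {e f : HEdge C V}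
    (h : κ.Parallel e f) (v : V) : v ∈ e.1 ↔ v ∈ f.1 := by
  cases κ with
  | sameEdge => exact (show e = f from h) ▸ Iff.rfl
  | sameTuple => exact (show e.1 = f.1 from h) ▸ Iff.rfl
  | sameVertices => exact h v

namespace DirHypergraph

variable {κ : MultiRule} {C : Type*}

/-- An isomorphism: a bijection of the vertices preserving edges, their directions and
colours. -/
structure Iso (G H : DirHypergraph κ C) where
  toEquiv : G.V ≃ H.V
  mem_edges_iff : ∀ e : HEdge C G.V, e.map toEquiv ∈ H.edges ↔ e ∈ G.edges

/-- The subhypergraph `H[U]` induced by a set `U` of vertices: its edges are those edges of `H`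
all of whose vertices are in `U`. -/
def induce (H : DirHypergraph κ C) (U : Set H.V) : DirHypergraph κ C where
  V := U
  edges := {e | e.map Subtype.val ∈ H.edges}
  finite_vertices := by have := H.finite_vertices; infer_instance
  finite_edges := H.finite_edges.preimage (HEdge.map_injective Subtype.val_injective).injOn
  nodup e he := List.Nodup.of_map _ (H.nodup _ he)
  two_le e he := by simpa [HEdge.map] using H.two_le _ he
  simple e he f hf h := HEdge.map_injective Subtype.val_injective
    (H.simple _ he _ hf ((κ.parallel_map_iff Subtype.val_injective e f).2 h))

/-- `K ≤ H`: `K` is an induced-subhypergraph of `H`, up to isomorphism. -/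
def IsInducedSub (K H : DirHypergraph κ C) : Prop :=
  ∃ U : Set H.V, Nonempty (Iso K (H.induce U))

/-- Disjoint union of a finite indexed family of hypergraphs. -/
def disjUnion {ι : Type} [Finite ι] (G : ι → DirHypergraph κ C) : DirHypergraph κ C where
  V := Σ i, (G i).V
  edges := {e | ∃ i, ∃ f ∈ (G i).edges, f.map (Sigma.mk i) = e}
  finite_vertices := by have := fun i => (G i).finite_vertices; infer_instance
  finite_edges := by
    have h := Set.finite_iUnion fun i => (G i).finite_edges.image (HEdge.map (Sigma.mk i))
    refine h.subset ?_
    rintro e ⟨i, f, hf, rfl⟩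
    exact Set.mem_iUnion.2 ⟨i, f, hf, rfl⟩
  nodup := by
    rintro e ⟨i, f, hf, rfl⟩
    exact ((G i).nodup f hf).map sigma_mk_injective
  two_le := by
    rintro e ⟨i, f, hf, rfl⟩
    simpa [HEdge.map] using (G i).two_le f hf
  simple := by
    rintro e ⟨i, f, hf, rfl⟩ e' ⟨j, f', hf', rfl⟩ h
    obtain ⟨v, hv⟩ := List.exists_mem_of_length_pos (lt_of_lt_of_le two_pos ((G i).two_le f hf))
    have hm := (h.mem_iff ⟨i, v⟩).1 (List.mem_map_of_mem hv)
    obtain ⟨w, -, hw⟩ := List.mem_map.1 hm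
    obtain rfl : j = i := congrArg Sigma.fst hw
    have hi : Function.Injective (Sigma.mk (β := fun i => (G i).V) j) := sigma_mk_injective
    have h' := (κ.parallel_map_iff hi f f').1 h
    rw [(G j).simple f hf f' hf' h']

/-- `kG`: the disjoint union of `k` copies of `G`. -/
def copies (k : ℕ) (G : DirHypergraph κ C) : DirHypergraph κ C :=
  disjUnion fun _ : Fin k => G

/-- `K₁`: the hypergraph with one vertex and no edges. -/
def singleVertex (κ : MultiRule) (C : Type*) : DirHypergraph κ C where
  V := Unit
  edges := ∅
  finite_vertices := inferInstance
  finite_edges := Set.finite_empty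
  nodup _ h := h.elim
  two_le _ h := h.elim
  simple _ h := h.elim

/-- The part with index `i` of the ordered partition `(V₁, …, Vₙ)` of the vertex set that is
given by a map `p : V(H) → Fin n`, as an induced subhypergraph. -/
def part (H : DirHypergraph κ C) {n : ℕ} (p : H.V → Fin n) (i : Fin n) : DirHypergraph κ C :=
  H.induce {v | p v = i}

/-- The `*`-join `G₁ * ⋯ * Gₙ` of (disjoint copies of) `G₁, …, Gₙ`: all hypergraphs `H` with a
partition `(V₁, …, Vₙ)` of the vertex set such that `H[Vᵢ]` is (isomorphic to) `Gᵢ`. -/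
def join {n : ℕ} (G : Fin n → DirHypergraph κ C) : Set (DirHypergraph κ C) :=
  {H | ∃ p : H.V → Fin n, ∀ i, Nonempty (Iso (H.part p i) (G i))}

/-- A hypergraph property: a non-empty class closed under isomorphism. -/
structure IsProperty (P : Set (DirHypergraph κ C)) : Prop where
  nonempty : P.Nonempty
  iso_closed : ∀ G H : DirHypergraph κ C, Nonempty (Iso G H) → G ∈ P → H ∈ P

/-- An additive induced-hereditary property. -/
structure IsAdditiveInducedHereditary (P : Set (DirHypergraph κ C)) : Prop extends IsProperty P where
  hereditary : ∀ H ∈ P, ∀ K : DirHypergraph κ C, K.IsInducedSub H → K ∈ P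
  additive : ∀ G ∈ P, ∀ H ∈ P, disjUnion ![G, H] ∈ P

/-- The product `P₁ ∘ ⋯ ∘ Pₙ`: the hypergraphs whose vertex set has a partition
`(V₁, …, Vₙ)`, empty parts being allowed, such that `H[Vᵢ]` has property `Pᵢ` for all `i`. -/
def product {n : ℕ} (P : Fin n → Set (DirHypergraph κ C)) : Set (DirHypergraph κ C) :=
  {H | ∃ p : H.V → Fin n, ∀ i, H.part p i ∈ P i}

/-- A `P`-decomposition of `G` with `n` parts: a partition of the vertex set of `G` into
non-empty parts with `kG[V₁] * ⋯ * kG[Vₙ] ⊆ P` for all `k ≥ 1`. -/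
def IsDecomposition (P : Set (DirHypergraph κ C)) (G : DirHypergraph κ C) {n : ℕ}
    (p : G.V → Fin n) : Prop :=
  Function.Surjective p ∧ ∀ k : ℕ, 1 ≤ k → join (fun i => copies k (G.part p i)) ⊆ P

open Classical in
/-- `dec_P(G)`: the maximum number of parts in a `P`-decomposition of `G`, and `0` if `G ∉ P`.
The numbers of parts are bounded by the number of vertices. -/
noncomputable def decNumber (P : Set (DirHypergraph κ C)) (G : DirHypergraph κ C) : ℕ :=
  if G ∈ P then sSup {n : ℕ | ∃ p : G.V → Fin n, IsDecomposition P G p} else 0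

theorem bddAbove_parts (P : Set (DirHypergraph κ C)) (G : DirHypergraph κ C) :
    BddAbove {n : ℕ | ∃ p : G.V → Fin n, IsDecomposition P G p} := by
  refine ⟨Nat.card G.V, ?_⟩
  rintro n ⟨p, hp, -⟩
  have := G.finite_vertices
  simpa using Nat.card_le_card_of_surjective p hp

/-- `S(P)`: the `P`-strict hypergraphs, i.e. `G ∈ P` with `G * K₁ ⊈ P`. -/
def strict (P : Set (DirHypergraph κ C)) : Set (DirHypergraph κ C) :=
  {G | G ∈ P ∧ ¬ join ![G, singleVertex κ C] ⊆ P}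

/-- `dec(P)`: the minimum of `dec_P(G)` over all `P`-strict `G` (and `∞` if there is no such
`G`, which happens for the class of all hypergraphs). -/
noncomputable def dec (P : Set (DirHypergraph κ C)) : ℕ∞ :=
  ⨅ G ∈ strict P, (decNumber P G : ℕ∞)

/-- `P` is indecomposable if `dec(P) = 1`. -/
def IsIndecomposable (P : Set (DirHypergraph κ C)) : Prop :=
  dec P = 1

end DirHypergraph

/-! Decompositions are handled through blow-ups: `Blow G p` is the class of hypergraphs that inside
each class of `p` are disjoint unions of induced pieces of `G`, with arbitrary edges across classes.
By `isDecomposition_iff`, a surjective `p` is a decomposition of `G` exactly when `Blow G p ⊆ P`.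

For `m ≤ dec P` (`le_decNumber`), the partition of a strict `G` supplied by the factorisation is
itself a decomposition. Additivity keeps blow-ups of its parts in the factors, and an empty part
could absorb an extra vertex, contradicting strictness.

For `dec P ≤ m` (`exists_strict_decNumber_le`), let `K` be strict with the least number `n` of
parts. Every member of `P` containing `K` then has a decomposition into exactly `n` parts, and no
decomposition has more (`exists_decomposition`, `card_le_decNumber`). The Ramsey theorem
`exists_block_ramsey` makes partitions of blow-ups uniform: a factorisation colours the vertices of
`G` compatibly with all its blow-ups (`exists_colouring_of_blow_subset_product`), and a
decomposition of a suitable blow-up refines a given one on some copy of `G`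
(`exists_blow_forall_decomposition`). Since `n` is maximal, such refinements are trivial. Hence each
decomposition with `n` parts has an assignment of whole parts to factors (`assignments_nonempty`).

Choose a decomposed `G` containing `K` with the fewest assignments, and let `c` be one of them. By
`exists_extension`, `G` lies in a decomposed `G'` in which the parts sent to `Q l` by `c` contain a
strict `X l` of decomposability number 1. By minimality `c` is still an assignment for `G'`. The
parts sent to `Q l` decompose a member of `Q l` containing `X l`, so there is at most one of them.
Thus `c` is injective and `n ≤ m`. -/

namespace HEdge

/-! ### Edges under vertex maps -/

variable {C : Type*} {U V W : Type}

theorem map_map (f : U → V) (g : V → W) (e : HEdge C U) : (e.map f).map g = e.map (g ∘ f) := by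
  simp [HEdge.map]

theorem map_congr {f g : V → W} {e : HEdge C V} (h : ∀ v ∈ e.1, f v = g v) : e.map f = e.map g :=
  congrArg (·, e.2) (List.map_congr_left h)

theorem map_id (e : HEdge C V) : e.map id = e := by
  simp [HEdge.map]

/-- An edge all of whose vertices lie in the range of `f` is an image under `f`. -/
theorem exists_map_eq {f : V → W} {e : HEdge C W} (h : ∀ w ∈ e.1, ∃ v, f v = w) :
    ∃ e' : HEdge C V, e'.map f = e := by
  obtain ⟨l, c⟩ := e
  have : l ∈ Set.range (List.map f) := by rw [Set.range_list_map]; exact h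
  obtain ⟨l', rfl⟩ := this
  exact ⟨(l', c), rfl⟩

/-- `g` is constant on the vertices of `e`. -/
def ConstOn {α : Type*} (g : V → α) (e : HEdge C V) : Prop :=
  ∀ u ∈ e.1, ∀ v ∈ e.1, g u = g v

theorem constOn_map {α : Type*} (g : W → α) (f : V → W) (e : HEdge C V) :
    ConstOn g (e.map f) ↔ ConstOn (g ∘ f) e := by
  simp [ConstOn, HEdge.map]

theorem ConstOn.comp {α β : Type*} {g : V → α} {e : HEdge C V} (h : ConstOn g e) (k : α → β) :
    ConstOn (k ∘ g) e :=
  fun u hu v hv => congrArg k (h u hu v hv)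

theorem ConstOn.of_const {α : Type*} {g : V → α} {a : α} (h : ∀ v, g v = a) (e : HEdge C V) :
    ConstOn g e :=
  fun u _ v _ => (h u).trans (h v).symm

theorem ConstOn.of_mem_iff {α : Type*} {g : V → α} {e e' : HEdge C V}
    (h : ∀ v, v ∈ e.1 ↔ v ∈ e'.1) (he : ConstOn g e) : ConstOn g e' :=
  fun u hu v hv => he u ((h u).2 hu) v ((h v).2 hv)

theorem finite_preimage_map [Finite V] (f : V → W) {S : Set (HEdge C W)} (hS : S.Finite) :
    {e : HEdge C V | e.map f ∈ S}.Finite := by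
  refine Set.Finite.preimage' (f := HEdge.map f) hS fun b _ => ?_
  refine Set.Finite.subset ((List.finite_length_eq V b.1.length).prod (Set.finite_singleton b.2)) ?_
  rintro e (rfl : HEdge.map f e = b)
  simp [HEdge.map]

end HEdge

theorem MultiRule.Parallel.map {C : Type*} {V W : Type} {κ : MultiRule} {e e' : HEdge C V}
    (h : κ.Parallel e e') (f : V → W) : κ.Parallel (e.map f) (e'.map f) := by
  cases κ with
  | sameEdge => exact congrArg _ h
  | sameTuple => exact congrArg (List.map f) h
  | sameVertices =>
    intro w
    simp only [HEdge.map, List.mem_map]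
    exact exists_congr fun v => and_congr_left fun _ => h v

/-- Edges on the same vertices with the same repetition-free image are equal. -/
theorem HEdge.eq_of_map_eq {C : Type*} {V W : Type} {e e' : HEdge C V}
    (h : ∀ v, v ∈ e.1 ↔ v ∈ e'.1) (f : V → W) (hm : e.map f = e'.map f)
    (hn : (e.map f).1.Nodup) : e = e' := by
  have h2 : e.2 = e'.2 := (Prod.mk.inj hm).2
  have h1 : e.1.map f = e'.1.map f := (Prod.mk.inj hm).1
  have hinj := List.inj_on_of_nodup_map hn
  refine Prod.ext (List.ext_getElem (by simpa using congrArg List.length h1) ?_) h2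
  intro i hi hi'
  refine hinj (List.getElem_mem _) ((h _).2 (List.getElem_mem _)) ?_
  have := List.getElem_of_eq h1 (i := i) (by simpa using hi)
  simpa using this

/-! ### Constructions of edge sets -/

namespace DirHypergraph

variable {κ : MultiRule} {C : Type*}

/-- The requirements on the set of edges of a hypergraph. -/
structure IsHyp (κ : MultiRule) {C : Type*} {V : Type} (E : Set (HEdge C V)) : Prop where
  finite_edges : E.Finite
  nodup : ∀ e ∈ E, e.1.Nodup
  two_le : ∀ e ∈ E, 2 ≤ e.1.length
  simple : ∀ e ∈ E, ∀ f ∈ E, κ.Parallel e f → e = f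

/-- The hypergraph with a given set of edges. -/
def ofEdges {V : Type} [Finite V] {E : Set (HEdge C V)} (h : IsHyp κ E) : DirHypergraph κ C where
  V := V
  edges := E
  finite_vertices := inferInstance
  finite_edges := h.finite_edges
  nodup := h.nodup
  two_le := h.two_le
  simple := h.simple

theorem isHyp (G : DirHypergraph κ C) : IsHyp κ G.edges :=
  ⟨G.finite_edges, G.nodup, G.two_le, G.simple⟩

namespace IsHyp

variable {V W : Type}

theorem empty : IsHyp κ (∅ : Set (HEdge C V)) :=
  ⟨Set.finite_empty, by simp, by simp, by simp⟩

theorem mono {E F : Set (HEdge C V)} (h : IsHyp κ F) (hs : E ⊆ F) : IsHyp κ E :=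
  ⟨h.finite_edges.subset hs, fun e he => h.nodup e (hs he), fun e he => h.two_le e (hs he),
    fun e he f hf => h.simple e (hs he) f (hs hf)⟩

/-- Injectivity of `f` is not needed. Edges of `E` repeat no vertex, so `f` is injective on each
edge pulled back. Parallel edges have parallel, hence equal, images, and a repetition-free image
determines an edge on a given vertex set. -/
theorem pull [Finite V] {E : Set (HEdge C W)} (h : IsHyp κ E) (f : V → W) :
    IsHyp κ {e : HEdge C V | e.map f ∈ E} where
  finite_edges := HEdge.finite_preimage_map f h.finite_edges
  nodup e he := List.Nodup.of_map _ (h.nodup _ he)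
  two_le e he := by simpa [HEdge.map] using h.two_le _ he
  simple e he e' he' hp := HEdge.eq_of_map_eq hp.mem_iff f
    (h.simple _ he _ he' (hp.map f)) (h.nodup _ he)

theorem push {E : Set (HEdge C V)} (h : IsHyp κ E) {f : V → W} (hf : Function.Injective f) :
    IsHyp κ (HEdge.map f '' E) where
  finite_edges := h.finite_edges.image _
  nodup := by
    rintro _ ⟨e, he, rfl⟩
    exact (h.nodup e he).map hf
  two_le := by
    rintro _ ⟨e, he, rfl⟩
    simpa [HEdge.map] using h.two_le e he
  simple := by
    rintro _ ⟨e, he, rfl⟩ _ ⟨e', he', rfl⟩ hp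
    rw [h.simple e he e' he' ((κ.parallel_map_iff hf e e').1 hp)]

/-- Under each of the three conventions parallel edges have the same vertices. A test `R` that
depends only on the vertex set therefore puts them on the same side, so gluing creates no multiple
edges. -/
theorem ite {E F : Set (HEdge C V)} (hE : IsHyp κ E) (hF : IsHyp κ F) {R : HEdge C V → Prop}
    (hR : ∀ e e', (∀ v, v ∈ e.1 ↔ v ∈ e'.1) → R e → R e') :
    IsHyp κ {e | (R e ∧ e ∈ E) ∨ (¬ R e ∧ e ∈ F)} where
  finite_edges := (hE.finite_edges.union hF.finite_edges).subset
    fun e he => he.imp And.right And.right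
  nodup e he := he.elim (fun h => hE.nodup e h.2) fun h => hF.nodup e h.2
  two_le e he := he.elim (fun h => hE.two_le e h.2) fun h => hF.two_le e h.2
  simple := by
    rintro e (⟨hr, he⟩ | ⟨hr, he⟩) e' (⟨hr', he'⟩ | ⟨hr', he'⟩) hp
    · exact hE.simple e he e' he' hp
    · exact absurd (hR e e' hp.mem_iff hr) hr'
    · exact absurd (hR e' e (fun v => (hp.mem_iff v).symm) hr') hr
    · exact hF.simple e he e' he' hp

end IsHyp

theorem exists_ne_of_mem_edges {G : DirHypergraph κ C} {e : HEdge C G.V} (he : e ∈ G.edges) :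
    ∃ u ∈ e.1, ∃ v ∈ e.1, u ≠ v := by
  have h2 := G.two_le e he
  refine ⟨e.1[0], List.getElem_mem _, e.1[1], List.getElem_mem _, fun h => ?_⟩
  exact zero_ne_one ((G.nodup e he).getElem_inj_iff.1 h)

/-! ### Embeddings, heredity and additivity -/

/-- `f` is an isomorphism onto an induced subhypergraph. -/
def IsEmb {K H : DirHypergraph κ C} (f : K.V → H.V) : Prop :=
  Function.Injective f ∧ ∀ e : HEdge C K.V, e.map f ∈ H.edges ↔ e ∈ K.edges

theorem IsEmb.comp {K H L : DirHypergraph κ C} {g : H.V → L.V} {f : K.V → H.V} (hg : IsEmb g)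
    (hf : IsEmb f) : IsEmb (g ∘ f) :=
  ⟨hg.1.comp hf.1, fun e => by rw [← HEdge.map_map, hg.2, hf.2]⟩

theorem Iso.isEmb {K H : DirHypergraph κ C} (i : Iso K H) : IsEmb i.toEquiv :=
  ⟨i.toEquiv.injective, i.mem_edges_iff⟩

/-- The inverse isomorphism. -/
def Iso.symm {K H : DirHypergraph κ C} (i : Iso K H) : Iso H K where
  toEquiv := i.toEquiv.symm
  mem_edges_iff e := by
    rw [← i.mem_edges_iff, HEdge.map_map, Equiv.self_comp_symm, HEdge.map_id]

theorem isEmb_val (H : DirHypergraph κ C) (U : Set H.V) :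
    IsEmb (K := H.induce U) (H := H) (Subtype.val : U → H.V) :=
  ⟨Subtype.val_injective, fun _ => Iff.rfl⟩

theorem isInducedSub_iff {K H : DirHypergraph κ C} :
    K.IsInducedSub H ↔ ∃ f : K.V → H.V, IsEmb f := by
  constructor
  · rintro ⟨U, ⟨i⟩⟩
    exact ⟨_, (isEmb_val H U).comp i.isEmb⟩
  · rintro ⟨f, hf⟩
    refine ⟨Set.range f, ⟨⟨Equiv.ofInjective f hf.1, fun e => ?_⟩⟩⟩
    rw [← hf.2 e]
    exact iff_of_eq (congrArg (· ∈ H.edges) (HEdge.map_map _ (Subtype.val : Set.range f → H.V) e))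

/-- An embedding whose image lies in `U` is an embedding into `H[U]`. -/
theorem IsEmb.codRestrict {K H : DirHypergraph κ C} {f : K.V → H.V} (hf : IsEmb f) {U : Set H.V}
    (hU : ∀ v, f v ∈ U) : IsEmb (H := H.induce U) (fun v => (⟨f v, hU v⟩ : U)) := by
  refine ⟨fun u v h => hf.1 (congrArg Subtype.val h), fun e => ?_⟩
  rw [← hf.2 e]
  exact iff_of_eq (congrArg (· ∈ H.edges) (HEdge.map_map _ (Subtype.val : U → H.V) e))

namespace IsAdditiveInducedHereditary

variable {Q : Set (DirHypergraph κ C)}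

theorem mem_of_isEmb (hQ : IsAdditiveInducedHereditary Q) {K H : DirHypergraph κ C}
    {f : K.V → H.V} (hf : IsEmb f) (hH : H ∈ Q) : K ∈ Q :=
  hQ.hereditary H hH K (isInducedSub_iff.2 ⟨f, hf⟩)

theorem mem_of_isEmpty (hQ : IsAdditiveInducedHereditary Q) (K : DirHypergraph κ C) [IsEmpty K.V] :
    K ∈ Q := by
  obtain ⟨H, hH⟩ := hQ.nonempty
  refine hQ.mem_of_isEmb (f := fun v => isEmptyElim v) ⟨fun v => isEmptyElim v, fun e => ?_⟩ hH
  have : e.1 = [] := List.eq_nil_iff_forall_not_mem.2 fun v => isEmptyElim v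
  constructor
  · intro h
    have := H.two_le _ h
    simp_all [HEdge.map]
  · intro h
    have := K.two_le _ h
    simp_all

/-- No edge crosses between `U` and its complement, so `X` embeds into the disjoint union of the two
induced pieces. -/
theorem mem_of_split (hQ : IsAdditiveInducedHereditary Q) (X : DirHypergraph κ C) (U : Set X.V)
    (hc : ∀ e ∈ X.edges, HEdge.ConstOn (· ∈ U) e) (h1 : X.induce U ∈ Q) (h2 : X.induce Uᶜ ∈ Q) :
    X ∈ Q := by
  classical
  let s : X.V → (disjUnion ![X.induce U, X.induce Uᶜ]).V := fun v =>
    if h : v ∈ U then ⟨0, ⟨v, h⟩⟩ else ⟨1, ⟨v, h⟩⟩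
  have s1 : ∀ v : U, s v.1 = ⟨0, v⟩ := fun v => dif_pos v.2
  have s2 : ∀ v : (Uᶜ : Set X.V), s v.1 = ⟨1, v⟩ := fun v => dif_neg v.2
  have hs : Function.Injective s := by
    intro u v h
    by_cases hu : u ∈ U <;> by_cases hv : v ∈ U
    · rw [s1 ⟨u, hu⟩, s1 ⟨v, hv⟩] at h
      exact congrArg Subtype.val (eq_of_heq (Sigma.mk.inj h).2)
    · rw [s1 ⟨u, hu⟩, s2 ⟨v, hv⟩] at h
      exact absurd (Sigma.mk.inj h).1 (by decide)
    · rw [s2 ⟨u, hu⟩, s1 ⟨v, hv⟩] at h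
      exact absurd (Sigma.mk.inj h).1 (by decide)
    · rw [s2 ⟨u, hu⟩, s2 ⟨v, hv⟩] at h
      exact congrArg Subtype.val (eq_of_heq (Sigma.mk.inj h).2)
  refine hQ.mem_of_isEmb (f := s) ⟨hs, fun e => ⟨?_, fun he => ?_⟩⟩ (hQ.additive _ h1 _ h2)
  · rintro ⟨i, f, hf, h⟩
    fin_cases i
    · have hf' : HEdge.map Subtype.val f ∈ X.edges := hf
      have hm : e = HEdge.map Subtype.val f := HEdge.map_injective hs (h.symm.trans
        ((HEdge.map_congr fun v _ => (s1 v).symm).trans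
          (HEdge.map_map (Subtype.val : U → X.V) s f).symm))
      exact hm ▸ hf'
    · have hf' : HEdge.map Subtype.val f ∈ X.edges := hf
      have hm : e = HEdge.map Subtype.val f := HEdge.map_injective hs (h.symm.trans
        ((HEdge.map_congr fun v _ => (s2 v).symm).trans
          (HEdge.map_map (Subtype.val : (Uᶜ : Set X.V) → X.V) s f).symm))
      exact hm ▸ hf'
  · obtain ⟨u, hu, -⟩ := exists_ne_of_mem_edges he
    have hc := hc e he
    by_cases huU : u ∈ U
    · obtain ⟨e', rfl⟩ := HEdge.exists_map_eq (f := (Subtype.val : U → X.V)) (e := e)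
        fun w hw => ⟨⟨w, (hc u hu w hw).mp huU⟩, rfl⟩
      refine ⟨0, e', he, ?_⟩
      rw [HEdge.map_map]
      exact HEdge.map_congr fun v _ => (s1 v).symm
    · obtain ⟨e', rfl⟩ := HEdge.exists_map_eq (f := (Subtype.val : (Uᶜ : Set X.V) → X.V)) (e := e)
        fun w hw => ⟨⟨w, fun hw' => huU ((hc u hu w hw).mpr hw')⟩, rfl⟩
      refine ⟨1, e', he, ?_⟩
      rw [HEdge.map_map]
      exact HEdge.map_congr fun v _ => (s2 v).symm

/-- A hypergraph is in `Q` if the fibres of a map that is constant on edges are in `Q`. -/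
theorem mem_of_fibers (hQ : IsAdditiveInducedHereditary Q) (X : DirHypergraph κ C) {β : Type}
    (b : X.V → β) (hc : ∀ e ∈ X.edges, HEdge.ConstOn b e)
    (h : ∀ i, X.induce {v | b v = i} ∈ Q) : X ∈ Q := by
  classical
  -- `β` may be infinite, but only the finite range of `b` matters, so one value at a time is split
  -- off.
  have key : ∀ s : Finset β, X.induce {v | b v ∈ s} ∈ Q := by
    intro s
    induction s using Finset.induction_on with
    | empty =>
      have : IsEmpty (X.induce {v | b v ∈ (∅ : Finset β)}).V := ⟨fun v => absurd v.2 (by simp)⟩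
      exact hQ.mem_of_isEmpty _
    | insert a s _ ih =>
      refine hQ.mem_of_split _ {v | b v.1 = a} (fun e he => ?_) ?_ ?_
      · have := hc _ he
        exact ((HEdge.constOn_map b (Subtype.val : {v | b v ∈ insert a s} → X.V) e).1 this).comp
          (· = a)
      · exact hQ.mem_of_isEmb (((isEmb_val X _).comp (isEmb_val _ _)).codRestrict fun v => v.2) (h a)
      · refine hQ.mem_of_isEmb (((isEmb_val X _).comp (isEmb_val _ _)).codRestrict fun v => ?_) ih
        exact (Finset.mem_insert.1 v.1.2).resolve_left v.2
  have := X.finite_vertices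
  have hfin := Set.toFinite (Set.range b)
  exact hQ.mem_of_isEmb (f := fun v => (⟨v, by simp⟩ : {v | b v ∈ hfin.toFinset}))
    ⟨fun u v h => congrArg Subtype.val h, fun e => by
      change HEdge.map Subtype.val (HEdge.map _ e) ∈ X.edges ↔ _
      rw [HEdge.map_map]
      exact (iff_of_eq (congrArg (· ∈ X.edges) (HEdge.map_id e)))⟩ (key hfin.toFinset)

end IsAdditiveInducedHereditary

/-! ### Blow-ups and a Ramsey theorem for blocks -/

/-- `φ` and `b` present `H` as a hypergraph whose vertices are labelled copies of vertices of `G`,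
such that on each class of `p` it is a disjoint union (indexed by `b`) of induced subhypergraphs
of `G`. -/
structure IsBlow {G H : DirHypergraph κ C} {ι : Type*} (p : G.V → ι) {β : Type} (φ : H.V → G.V)
    (b : H.V → β) : Prop where
  inj : Function.Injective fun v => (φ v, b v)
  mem_iff : ∀ e : HEdge C H.V, HEdge.ConstOn (p ∘ φ) e →
    (e ∈ H.edges ↔ HEdge.ConstOn b e ∧ e.map φ ∈ G.edges)

/-- The hypergraphs that are partitioned into induced subhypergraphs of disjoint unions of copies
of the parts of `G` given by `p`. -/
def Blow (G : DirHypergraph κ C) {ι : Type*} (p : G.V → ι) : Set (DirHypergraph κ C) :=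
  {H | ∃ (β : Type) (φ : H.V → G.V) (b : H.V → β), IsBlow p φ b}

/-- Edge sets on `β × V(G)` for which all blocks are copies of `G` and no other edge lies inside a
class of `p`. -/
structure IsBlock (G : DirHypergraph κ C) {ι : Type*} (p : G.V → ι) {β : Type}
    (E : Set (HEdge C (β × G.V))) : Prop where
  isHyp : IsHyp κ E
  block : ∀ e, HEdge.ConstOn Prod.fst e → (e ∈ E ↔ e.map Prod.snd ∈ G.edges)
  typed : ∀ e ∈ E, HEdge.ConstOn (p ∘ Prod.snd) e → HEdge.ConstOn Prod.fst e

/-- Substitution of a block hypergraph into the blocks of another one. -/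
def substEdges {C : Type*} {X α β : Type} (E : Set (HEdge C (α × X)))
    (F : Set (HEdge C (β × X))) : Set (HEdge C ((α × β) × X)) :=
  {e | (HEdge.ConstOn (fun v => v.1.1) e ∧ e ∈ {e | e.map (fun v => (v.1.2, v.2)) ∈ F}) ∨
    (¬ HEdge.ConstOn (fun v => v.1.1) e ∧ e ∈ {e | e.map (fun v => (v.1.1, v.2)) ∈ E})}

theorem mem_substEdges_of_constOn {X α β : Type} {E : Set (HEdge C (α × X))}
    {F : Set (HEdge C (β × X))} {e : HEdge C ((α × β) × X)}
    (h : HEdge.ConstOn (fun v => v.1.1) e) :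
    e ∈ substEdges E F ↔ e.map (fun v => (v.1.2, v.2)) ∈ F := by
  simp [substEdges, h]

theorem mem_substEdges_of_not_constOn {X α β : Type} {E : Set (HEdge C (α × X))}
    {F : Set (HEdge C (β × X))} {e : HEdge C ((α × β) × X)}
    (h : ¬ HEdge.ConstOn (fun v => v.1.1) e) :
    e ∈ substEdges E F ↔ e.map (fun v => (v.1.1, v.2)) ∈ E := by
  simp [substEdges, h]

theorem IsBlock.subst {G : DirHypergraph κ C} {ι : Type*} {p : G.V → ι} {α β : Type}
    [Finite α] [Finite β] {E : Set (HEdge C (α × G.V))} {F : Set (HEdge C (β × G.V))}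
    (hE : IsBlock G p E) (hF : IsBlock G p F) : IsBlock G p (substEdges E F) where
  isHyp := by
    have := G.finite_vertices
    exact (hF.isHyp.pull _).ite (hE.isHyp.pull _) fun e e' h he => he.of_mem_iff h
  block e he := by
    rw [mem_substEdges_of_constOn (he.comp Prod.fst), hF.block, HEdge.map_map]
    · rfl
    · rw [HEdge.constOn_map]
      exact he.comp Prod.snd
  typed e he hp := by
    by_cases h : HEdge.ConstOn (fun v => v.1.1) e
    · rw [mem_substEdges_of_constOn h] at he
      have := hF.typed _ he ((HEdge.constOn_map _ _ _).2 hp)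
      rw [HEdge.constOn_map] at this
      exact fun u hu v hv => Prod.ext (h u hu v hv) (this u hu v hv)
    · rw [mem_substEdges_of_not_constOn h] at he
      have := hE.typed _ he ((HEdge.constOn_map _ _ _).2 hp)
      rw [HEdge.constOn_map] at this
      exact absurd this h

/-- A colouring theorem for blocks: some hypergraph contains, for every colouring and for some
pattern `f` in `L`, the block hypergraph `E f` with all blocks coloured by `f`, or else a block
with pattern not in `L`. -/
theorem exists_block_ramsey (G : DirHypergraph κ C) {ι γ : Type*} (p : G.V → ι)
    (α : (G.V → γ) → Type) [∀ f, Finite (α f)] [∀ f, Nonempty (α f)]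
    (E : ∀ f, Set (HEdge C (α f × G.V))) (hE : ∀ f, IsBlock G p (E f)) (L : Finset (G.V → γ)) :
    ∃ (β : Type) (_ : Finite β) (_ : Nonempty β) (F : Set (HEdge C (β × G.V))), IsBlock G p F ∧
      ∀ χ : β × G.V → γ, (∃ f ∈ L, ∃ g : α f → β, Function.Injective g ∧
        (∀ a x, χ (g a, x) = f x) ∧ ∀ e, e.map (Prod.map g id) ∈ F ↔ e ∈ E f) ∨
        ∃ b, (fun x => χ (b, x)) ∉ L := by
  classical
  induction L using Finset.induction_on with
  | empty =>
    have := G.finite_vertices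
    refine ⟨Unit, inferInstance, inferInstance, _, ⟨G.isHyp.pull Prod.snd, fun e _ => Iff.rfl,
      fun e _ _ => HEdge.ConstOn.of_const (a := ()) (fun _ => rfl) e⟩, fun χ => Or.inr ⟨(), by simp⟩⟩
  | insert f L _ ih =>
    obtain ⟨β, _, _, F, hF, h⟩ := ih
    -- Each block of `E f` is replaced by a copy of `F`. Edges meeting several of these copies are
    -- read off from `E f` alone, so choosing one `F`-block in each copy recovers `E f`.
    refine ⟨α f × β, inferInstance, inferInstance, _, (hE f).subst hF, fun χ => ?_⟩
    by_cases hgood : ∃ a, ∃ f ∈ L, ∃ g : α f → β, Function.Injective g ∧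
        (∀ a' x, χ ((a, g a'), x) = f x) ∧ ∀ e, e.map (Prod.map g id) ∈ F ↔ e ∈ E f
    · obtain ⟨a, f', hf', g, hg, hχ, hgE⟩ := hgood
      refine Or.inl ⟨f', Finset.mem_insert_of_mem hf', fun a' => (a, g a'),
        fun x y hxy => hg (congrArg Prod.snd hxy), hχ, fun e => ?_⟩
      rw [mem_substEdges_of_constOn, HEdge.map_map, ← hgE]
      · rfl
      · rw [HEdge.constOn_map]
        exact HEdge.ConstOn.of_const (fun _ => rfl) e
    -- Every copy of `F` now has a block with pattern outside `L`. If all the chosen patterns are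
    -- `f`, these blocks form `E f`; otherwise one of them lies outside `insert f L`.
    · have hbad : ∀ a, ∃ b, (fun x => χ ((a, b), x)) ∉ L := fun a =>
        (h fun v => χ ((a, v.1), v.2)).resolve_left fun ⟨f', hf', hh⟩ => hgood ⟨a, f', hf', hh⟩
      choose c hc using hbad
      by_cases hall : ∀ a, (fun x => χ ((a, c a), x)) = f
      · refine Or.inl ⟨f, Finset.mem_insert_self _ _, fun a => (a, c a),
          fun x y hxy => congrArg Prod.fst hxy, fun a x => congrFun (hall a) x, fun e => ?_⟩
        by_cases he : HEdge.ConstOn Prod.fst e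
        · rw [((hE f).subst hF).block, (hE f).block e he, HEdge.map_map]
          · rfl
          · rw [HEdge.constOn_map]
            exact he.comp fun a => (a, c a)
        · rw [mem_substEdges_of_not_constOn, HEdge.map_map]
          · exact iff_of_eq (congrArg (· ∈ E f) (HEdge.map_id e))
          · rw [HEdge.constOn_map]
            exact he
      · obtain ⟨a, ha⟩ := not_forall.1 hall
        exact Or.inr ⟨(a, c a), by simp [ha, hc]⟩

/-- A blow-up for a finer partition, presented inside a block hypergraph. -/
theorem IsBlow.exists_isBlock {G T : DirHypergraph κ C} {ι : Type} {γ : Type} {p : G.V → ι}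
    {f : G.V → γ} {β : Type} {φ : T.V → G.V} {b : T.V → β}
    (h : IsBlow (fun v => (p v, f v)) φ b) :
    ∃ (α : Type) (_ : Finite α) (_ : Nonempty α) (E : Set (HEdge C (α × G.V))) (a : T.V → α),
      IsBlock G p E ∧ Function.Injective (fun v => (a v, φ v)) ∧
      ∀ e : HEdge C T.V, HEdge.ConstOn (f ∘ φ) e →
        (e.map (fun v => (a v, φ v)) ∈ E ↔ e ∈ T.edges) := by
  have := T.finite_vertices
  have := G.finite_vertices
  -- Blocks are cut up along the classes of `(p, f)`, so that on each new block `T` agrees with `G`.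
  let b' : T.V → β × ι × γ := fun v => (b v, p (φ v), f (φ v))
  -- `Option` keeps the index type non-empty even if `T` has no vertices.
  let a : T.V → Option (Set.range b') := fun v => some ⟨b' v, v, rfl⟩
  have ha : ∀ u v, a u = a v ↔ b' u = b' v := fun u v =>
    (Option.some_inj).trans Subtype.mk_eq_mk
  have hca : ∀ e : HEdge C T.V, HEdge.ConstOn a e ↔ HEdge.ConstOn b' e := fun e => by
    simp only [HEdge.ConstOn, ha]
  have hψ : Function.Injective (fun v => (a v, φ v)) := by
    intro u v huv
    have h1 := (ha u v).1 (congrArg Prod.fst huv)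
    exact h.inj (Prod.ext (congrArg Prod.snd huv) (congrArg Prod.fst h1))
  -- Only edges inside a class of `f` are kept. If such an edge is also inside a class of `p`, it is
  -- inside a class of `(p, f)` and hence inside one block, as `IsBlock` requires.
  let T' : Set (HEdge C T.V) := {e | e ∈ T.edges ∧ HEdge.ConstOn (f ∘ φ) e}
  have hT' : IsHyp κ T' := T.isHyp.mono fun e he => he.1
  have hR : ∀ e : HEdge C T.V, HEdge.ConstOn Prod.fst (e.map fun v => (a v, φ v)) ↔
      HEdge.ConstOn b' e := fun e => by
    rw [HEdge.constOn_map, ← hca]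
    rfl
  refine ⟨Option (Set.range b'), inferInstance, inferInstance, _, a,
    ⟨(G.isHyp.pull Prod.snd).ite (R := HEdge.ConstOn Prod.fst) (hT'.push hψ)
      fun e e' h he => he.of_mem_iff h, fun e he => by simp [he], ?_⟩, hψ, ?_⟩
  · rintro e (⟨he, -⟩ | ⟨-, e, ⟨he, hef⟩, rfl⟩) hp
    · exact he
    · rw [HEdge.constOn_map] at hp
      have hpf : HEdge.ConstOn ((fun v => (p v, f v)) ∘ φ) e := fun u hu v hv =>
        Prod.ext (hp u hu v hv) (hef u hu v hv)
      have hb := ((h.mem_iff e hpf).1 he).1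
      rw [hR]
      exact fun u hu v hv => Prod.ext (hb u hu v hv) (hpf u hu v hv)
  · intro e hef
    constructor
    · rintro (⟨he, hG⟩ | ⟨-, e', ⟨he, -⟩, hee⟩)
      · rw [hR] at he
        refine (h.mem_iff e (he.comp Prod.snd)).2 ⟨he.comp Prod.fst, ?_⟩
        rw [Set.mem_ofPred_eq, HEdge.map_map] at hG
        exact hG
      · exact HEdge.map_injective hψ hee ▸ he
    · intro he
      by_cases hb : HEdge.ConstOn b' e
      · refine Or.inl ⟨(hR e).2 hb, ?_⟩
        rw [Set.mem_ofPred_eq, HEdge.map_map]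
        exact ((h.mem_iff e (hb.comp Prod.snd)).1 he).2
      · exact Or.inr ⟨fun h' => hb ((hR e).1 h'), e, ⟨he, hef⟩, rfl⟩

/-- For any choice of blow-ups `T f` of `G`, some blow-up `H` of `G` contains, for every colouring
`χ`, a copy of `G` with pattern some `f` and the monochromatic parts of `T f`. -/
theorem exists_blow_ramsey (G : DirHypergraph κ C) {ι γ : Type} [Finite γ] [Nonempty γ]
    (p : G.V → ι) (T : (G.V → γ) → DirHypergraph κ C) (φ : ∀ f, (T f).V → G.V)
    (hT : ∀ f, ∃ (β : Type) (b : (T f).V → β), IsBlow (fun v => (p v, f v)) (φ f) b) :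
    ∃ (H : DirHypergraph κ C) (β : Type) (φH : H.V → G.V) (b : H.V → β), IsBlow p φH b ∧
      ∀ χ : H.V → γ, ∃ f, (∃ g : (T f).V → H.V, Function.Injective g ∧
        (∀ v, χ (g v) = f (φ f v)) ∧
        ∀ e : HEdge C (T f).V, HEdge.ConstOn (f ∘ φ f) e → (e.map g ∈ H.edges ↔ e ∈ (T f).edges)) ∧
        ∃ i : G.V → H.V, IsEmb i ∧ (∀ v, φH (i v) = v) ∧ ∀ v, χ (i v) = f v := by
  have := G.finite_vertices
  have := Fintype.ofFinite (G.V → γ)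
  choose β b hb using hT
  choose α hα hα' E a hE ha haE using fun f => (hb f).exists_isBlock
  obtain ⟨β, _, _, F, hF, h⟩ := exists_block_ramsey G p α E hE Finset.univ
  refine ⟨ofEdges hF.isHyp, β, Prod.snd, Prod.fst, ⟨fun u v huv => ?_, fun e he => ?_⟩,
    fun χ => ?_⟩
  · exact Prod.swap_injective huv
  · constructor
    · intro heF
      have hc := hF.typed e heF he
      exact ⟨hc, (hF.block e hc).1 heF⟩
    · rintro ⟨hc, heG⟩
      exact (hF.block e hc).2 heG
  -- All patterns are allowed, so the exceptional alternative of the Ramsey theorem cannot occur.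
  · obtain ⟨f, -, g, hg, hχ, hgE⟩ := (h χ).resolve_right (by simp)
    refine ⟨f, ⟨fun v => (g (a f v), φ f v), ?_, fun v => hχ _ _, fun e he => ?_⟩, ?_⟩
    · exact (hg.prodMap Function.injective_id).comp (ha f)
    · rw [← haE f e he, ← hgE, HEdge.map_map]
      rfl
    · obtain ⟨a₀⟩ := hα' f
      refine ⟨fun x => (g a₀, x), ⟨fun x y hxy => congrArg Prod.snd hxy, fun e => ?_⟩,
        fun _ => rfl, fun x => hχ _ _⟩
      have : HEdge.ConstOn Prod.fst (e.map fun x => (g a₀, x)) := by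
        rw [HEdge.constOn_map]
        exact HEdge.ConstOn.of_const (fun _ => rfl) e
      refine (hF.block _ this).trans ?_
      rw [HEdge.map_map]
      exact iff_of_eq (congrArg (· ∈ G.edges) (HEdge.map_id e))

/-! ### Functoriality of blow-ups and comparison with joins of copies -/

theorem IsBlow.of_refine {G H : DirHypergraph κ C} {ι ι' : Type*} {p : G.V → ι} {β : Type}
    {φ : H.V → G.V} {b : H.V → β} (h : IsBlow p φ b) {r : G.V → ι'}
    (hr : ∀ u v, r u = r v → p u = p v) : IsBlow r φ b :=
  ⟨h.inj, fun e he => h.mem_iff e fun u hu v hv => hr _ _ (he u hu v hv)⟩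

theorem blow_subset_of_refine {G : DirHypergraph κ C} {ι ι' : Type*} {p : G.V → ι} {r : G.V → ι'}
    (hr : ∀ u v, r u = r v → p u = p v) : Blow G p ⊆ Blow G r :=
  fun _ ⟨β, φ, b, h⟩ => ⟨β, φ, b, h.of_refine hr⟩

theorem IsBlow.map_isEmb {K G H : DirHypergraph κ C} {ι : Type*} {p : G.V → ι} {i : K.V → G.V}
    (hi : IsEmb i) {β : Type} {φ : H.V → K.V} {b : H.V → β} (h : IsBlow (p ∘ i) φ b) :
    IsBlow p (i ∘ φ) b :=
  ⟨fun _ _ huv => h.inj (Prod.ext (hi.1 (Prod.mk.inj huv).1) (Prod.mk.inj huv).2),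
    fun e he => by rw [h.mem_iff e he, ← HEdge.map_map, hi.2]⟩

theorem blow_subset_of_isEmb {K G : DirHypergraph κ C} {ι : Type*} {p : G.V → ι} {i : K.V → G.V}
    (hi : IsEmb i) : Blow K (p ∘ i) ⊆ Blow G p :=
  fun _ ⟨β, φ, b, h⟩ => ⟨β, i ∘ φ, b, h.map_isEmb hi⟩

theorem isBlow_id (G : DirHypergraph κ C) {ι : Type*} (p : G.V → ι) :
    IsBlow p (id : G.V → G.V) (fun _ => ()) :=
  ⟨fun _ _ h => congrArg Prod.fst h, fun e _ => by
    rw [HEdge.map_id]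
    exact ⟨fun h => ⟨HEdge.ConstOn.of_const (fun _ => rfl) e, h⟩, And.right⟩⟩

theorem mem_blow_self (G : DirHypergraph κ C) {ι : Type*} (p : G.V → ι) : G ∈ Blow G p :=
  ⟨_, _, _, isBlow_id G p⟩

/-- Restricting a blow-up to an induced subhypergraph. -/
theorem IsBlow.comp_isEmb {G H K : DirHypergraph κ C} {ι : Type*} {p : G.V → ι} {β : Type}
    {φ : H.V → G.V} {b : H.V → β} (h : IsBlow p φ b) {i : K.V → H.V} (hi : IsEmb i) :
    IsBlow p (φ ∘ i) (b ∘ i) :=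
  ⟨h.inj.comp hi.1, fun e he => by
    rw [← hi.2, h.mem_iff _ ((HEdge.constOn_map _ _ _).2 he), HEdge.constOn_map, HEdge.map_map]⟩

theorem join_copies_subset_blow {G : DirHypergraph κ C} {n : ℕ} (p : G.V → Fin n) (k : ℕ) :
    join (fun i => copies k (G.part p i)) ⊆ Blow G p := by
  rintro H ⟨q, hq⟩
  let iso := fun i => (hq i).some
  let s : ∀ v : H.V, (copies k (G.part p (q v))).V := fun v => (iso (q v)).toEquiv ⟨v, rfl⟩
  have hs : ∀ i (v : {v // q v = i}), ((s v.1).1, (s v.1).2.1) =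
      (((iso i).toEquiv v).1, ((iso i).toEquiv v).2.1) := by
    rintro i ⟨v, rfl⟩
    rfl
  have hφ : ∀ v, p (s v).2.1 = q v := fun v => (s v).2.2
  refine ⟨Fin k, fun v => (s v).2.1, fun v => (s v).1, fun u v huv => ?_, fun e he => ?_⟩
  · have hq' : q u = q v := by rw [← hφ u, ← hφ v]; exact congrArg p (congrArg Prod.fst huv)
    have hu := hs (q v) ⟨u, hq'⟩
    have hv := hs (q v) ⟨v, rfl⟩
    refine congrArg Subtype.val ((iso (q v)).toEquiv.injective (a₁ := ⟨u, hq'⟩) (a₂ := ⟨v, rfl⟩) ?_)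
    refine Sigma.ext ((congrArg Prod.fst hu).symm.trans ((congrArg Prod.snd huv).trans
      (congrArg Prod.fst hv))) (heq_of_eq (Subtype.ext ?_))
    exact (congrArg Prod.snd hu).symm.trans ((congrArg Prod.fst huv).trans
      (congrArg Prod.snd hv))
  · by_cases hne : ∃ v, v ∈ e.1
    swap
    · have h0 : e.1 = [] := List.eq_nil_iff_forall_not_mem.2 fun v hv => hne ⟨v, hv⟩
      constructor
      · intro h
        have := H.two_le _ h
        simp [h0] at this
      · intro h
        have := G.two_le _ h.2
        simp [h0, HEdge.map] at this
    obtain ⟨w, hw⟩ := hne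
    obtain ⟨i, hi⟩ : ∃ i, i = q w := ⟨_, rfl⟩
    have hqe : ∀ v ∈ e.1, q v = i := fun v hv => by
      rw [hi, ← hφ v, ← hφ w]
      exact he v hv w hw
    obtain ⟨e', rfl⟩ := HEdge.exists_map_eq (f := (Subtype.val : {v // q v = i} → H.V)) (e := e)
      fun v hv => ⟨⟨v, hqe v hv⟩, rfl⟩
    refine ((iso i).mem_edges_iff e').symm.trans ?_
    rw [HEdge.constOn_map, HEdge.map_map]
    constructor
    · rintro ⟨j, f, hf, hfe⟩
      have hj : ∀ v ∈ e'.1, ((iso i).toEquiv v).1 = j := fun v hv => by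
        have : (iso i).toEquiv v ∈ (HEdge.map (iso i).toEquiv e').1 := List.mem_map_of_mem hv
        rw [← hfe] at this
        obtain ⟨x, -, hx⟩ := List.mem_map.1 this
        rw [← hx]
      refine ⟨fun u hu v hv => ?_, ?_⟩
      · exact (congrArg Prod.fst (hs i u)).trans ((hj u hu).trans
          ((hj v hv).symm.trans (congrArg Prod.fst (hs i v)).symm))
      · have hf' : HEdge.map Subtype.val f ∈ G.edges := hf
        have : HEdge.map Subtype.val f = HEdge.map (fun v => (s v.1).2.1) e' := by
          have h1 : HEdge.map (fun x : Σ _ : Fin k, {v // p v = i} => x.2.1)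
              (HEdge.map (Sigma.mk j) f) = HEdge.map Subtype.val f := HEdge.map_map _ _ _
          rw [← h1]
          refine (congrArg _ hfe).trans ((HEdge.map_map _ _ _).trans (HEdge.map_congr fun v _ => ?_))
          exact (congrArg Prod.snd (hs i v)).symm
        exact this ▸ hf'
    · rintro ⟨hb, hG⟩
      have hw' : ∃ w', w' ∈ e'.1 := by
        obtain ⟨x, hx, -⟩ := List.mem_map.1 hw
        exact ⟨x, hx⟩
      obtain ⟨w', hw'⟩ := hw'
      refine ⟨((iso i).toEquiv w').1, HEdge.map (fun v => ((iso i).toEquiv v).2) e', ?_, ?_⟩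
      · change HEdge.map Subtype.val (HEdge.map _ e') ∈ G.edges
        refine (iff_of_eq (congrArg (· ∈ G.edges) ?_)).1 hG
        refine (HEdge.map_congr fun v _ => ?_).trans (HEdge.map_map _ _ _).symm
        exact congrArg Prod.snd (hs i v)
      · refine (HEdge.map_map _ _ _).trans (HEdge.map_congr fun v hv => ?_)
        refine Sigma.ext ?_ HEq.rfl
        exact (congrArg Prod.fst (hs i w')).symm.trans ((hb w' hw' v hv).trans
          (congrArg Prod.fst (hs i v)))

/-- A blow-up extends to a member of the join of copies of the parts. -/
theorem exists_isEmb_join_copies {G H : DirHypergraph κ C} {n : ℕ} {p : G.V → Fin n}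
    (hH : H ∈ Blow G p) : ∃ k, 1 ≤ k ∧ ∃ J ∈ join (fun i => copies k (G.part p i)),
      ∃ f : H.V → J.V, IsEmb f := by
  obtain ⟨β, φ, b₀, h₀⟩ := hH
  have := G.finite_vertices
  have := H.finite_vertices
  obtain ⟨k, hk, b, h⟩ : ∃ k, 1 ≤ k ∧ ∃ b : H.V → Fin k, IsBlow p φ b := by
    -- The labels in use are renumbered by `Fin k`; the extra element from `Option` guarantees `1 ≤
    -- k`.
    let eq := Finite.equivFin (Option (Set.range b₀))
    refine ⟨Nat.card (Option (Set.range b₀)), Nat.card_pos, fun v => eq (some ⟨b₀ v, v, rfl⟩), ?_⟩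
    have hb : ∀ u v, eq (some ⟨b₀ u, u, rfl⟩) = eq (some ⟨b₀ v, v, rfl⟩) ↔ b₀ u = b₀ v :=
      fun u v => eq.injective.eq_iff.trans ((Option.some_inj).trans Subtype.mk_eq_mk)
    refine ⟨fun u v huv => h₀.inj (Prod.ext (Prod.mk.inj huv).1
      ((hb u v).1 (Prod.mk.inj huv).2)), fun e he => ?_⟩
    rw [h₀.mem_iff e he]
    simp only [HEdge.ConstOn, hb]
  let ψ : H.V → G.V × Fin k := fun v => (φ v, b v)
  have hA : IsHyp κ {e : HEdge C (G.V × Fin k) | HEdge.ConstOn Prod.snd e ∧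
      e.map Prod.fst ∈ G.edges} := (G.isHyp.pull Prod.fst).mono fun e he => he.2
  -- Inside a class of `p` the edges are those of `k` full copies of `G`; across classes they are
  -- those of `H`. On the image of `ψ` this is `H`, by the blow-up condition.
  have hE := hA.ite (H.isHyp.push (f := ψ) h.inj) (R := HEdge.ConstOn fun v => p v.1)
    fun e e' hv he => he.of_mem_iff hv
  refine ⟨k, hk, ofEdges hE, ⟨fun v => p v.1, fun i => ⟨⟨⟨fun v => ⟨v.1.2, v.1.1, v.2⟩,
    fun x => ⟨(x.2.1, x.1), x.2.2⟩, fun v => rfl, fun x => rfl⟩, fun e => ?_⟩⟩⟩, ψ, h.inj,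
    fun e => ?_⟩
  · let val : {v : G.V × Fin k // p v.1 = i} → G.V × Fin k := Subtype.val
    let s : {v : G.V × Fin k // p v.1 = i} → {v // p v = i} := fun v => ⟨v.1.1, v.2⟩
    have hc : HEdge.ConstOn (fun v => p v.1) (HEdge.map val e) :=
      (HEdge.constOn_map (fun v => p v.1) val e).2 (HEdge.ConstOn.of_const (fun v => v.2) e)
    constructor
    · rintro ⟨j, f, hf, hfe⟩
      refine Or.inl ⟨hc, ?_, ?_⟩
      · refine (HEdge.constOn_map Prod.snd val e).2 ?_
        have hj : ∀ v ∈ e.1, v.1.2 = j := fun v hv => by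
          have : (⟨v.1.2, v.1.1, v.2⟩ : Σ _ : Fin k, {v // p v = i}) ∈ (HEdge.map (C := C)
            (Sigma.mk j) f).1 := hfe ▸ List.mem_map_of_mem hv
          obtain ⟨x, -, hx⟩ := List.mem_map.1 this
          exact (congrArg Sigma.fst hx).symm
        exact fun u hu v hv => (hj u hu).trans (hj v hv).symm
      · have hf' : HEdge.map Subtype.val f ∈ G.edges := hf
        refine (iff_of_eq (congrArg (· ∈ G.edges) ?_)).1 hf'
        have h1 : HEdge.map (fun x : Σ _ : Fin k, {v // p v = i} => x.2.1)
            (HEdge.map (Sigma.mk j) f) = HEdge.map Subtype.val f := HEdge.map_map _ _ _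
        refine h1.symm.trans ((congrArg _ hfe).trans ((HEdge.map_map _ _ _).trans ?_))
        exact (HEdge.map_map val Prod.fst e).symm
    · rintro (⟨-, hb, hG⟩ | ⟨h', -⟩)
      · replace hb := (HEdge.constOn_map Prod.snd val e).1 hb
        have hne : ∃ w, w ∈ e.1 := by
          have := G.two_le _ hG
          obtain ⟨w, hw⟩ := List.exists_mem_of_length_pos (lt_of_lt_of_le two_pos this)
          obtain ⟨w, hw, -⟩ := List.mem_map.1 hw
          obtain ⟨w, hw, -⟩ := List.mem_map.1 hw
          exact ⟨w, hw⟩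
        obtain ⟨w, hw⟩ := hne
        refine ⟨w.1.2, HEdge.map s e, ?_, ?_⟩
        · change HEdge.map Subtype.val (HEdge.map _ e) ∈ G.edges
          refine (iff_of_eq (congrArg (· ∈ G.edges) ?_)).1 hG
          exact (HEdge.map_map val Prod.fst e).trans
            (HEdge.map_map s Subtype.val e).symm
        · refine (HEdge.map_map _ _ _).trans (HEdge.map_congr fun v hv => ?_)
          exact Sigma.ext (hb w hw v hv) HEq.rfl
      · exact absurd hc h'
  · have hR : HEdge.ConstOn (fun v => p v.1) (e.map ψ) ↔ HEdge.ConstOn (p ∘ φ) e := by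
      rw [HEdge.constOn_map]
      rfl
    constructor
    · rintro (⟨hr, hb, hG⟩ | ⟨-, e', he', hee⟩)
      · exact (h.mem_iff e (hR.1 hr)).2 ⟨(HEdge.constOn_map Prod.snd ψ e).1 hb,
          (iff_of_eq (congrArg (· ∈ G.edges) (HEdge.map_map ψ Prod.fst e))).1 hG⟩
      · exact HEdge.map_injective h.inj hee ▸ he'
    · intro he
      by_cases hr : HEdge.ConstOn (p ∘ φ) e
      · obtain ⟨hb, hG⟩ := (h.mem_iff e hr).1 he
        exact Or.inl ⟨hR.2 hr, (HEdge.constOn_map _ _ _).2 hb,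
          (iff_of_eq (congrArg (· ∈ G.edges) (HEdge.map_map ψ Prod.fst e))).2 hG⟩
      · exact Or.inr ⟨fun h' => hr (hR.1 h'), e, he, rfl⟩

/-- Joins of copies are blow-ups and every blow-up embeds into such a join, so for hereditary `P`
the condition over all `k` becomes a single inclusion. -/
theorem isDecomposition_iff {P : Set (DirHypergraph κ C)} (hP : IsAdditiveInducedHereditary P)
    {G : DirHypergraph κ C} {n : ℕ} {p : G.V → Fin n} :
    IsDecomposition P G p ↔ Function.Surjective p ∧ Blow G p ⊆ P := by
  refine and_congr_right fun _ => ⟨fun h H hH => ?_, fun h k _ =>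
    (join_copies_subset_blow p k).trans h⟩
  obtain ⟨k, hk, J, hJ, f, hf⟩ := exists_isEmb_join_copies hH
  exact hP.mem_of_isEmb hf (h k hk hJ)

/-! ### Strict hypergraphs and the number of parts of a decomposition -/

theorem exists_iso_of_mem_join_singleVertex {G J : DirHypergraph κ C}
    (h : J ∈ join ![G, singleVertex κ C]) : ∃ w, Nonempty (Iso (J.induce {v | v ≠ w}) G) := by
  obtain ⟨q, hq⟩ : ∃ q : J.V → Fin 2, ∀ i,
    Nonempty (Iso (J.part q i) (![G, singleVertex κ C] i)) := h
  obtain ⟨i1⟩ := hq 1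
  let w := i1.toEquiv.symm ()
  have hw : ∀ v, q v = 1 ↔ v = w.1 := fun v =>
    ⟨fun hv => congrArg Subtype.val (i1.toEquiv.symm_apply_apply ⟨v, hv⟩).symm,
      fun hv => hv ▸ w.2⟩
  refine ⟨w.1, ?_⟩
  have hs : {v | v ≠ w.1} = {v | q v = 0} := by
    ext v
    have := hw v
    simp only [Set.mem_ofPred_eq, ne_eq, ← this]
    omega
  rw [hs]
  exact hq 0

theorem mem_join_singleVertex {G J : DirHypergraph κ C} {w : J.V}
    (h : Nonempty (Iso (J.induce {v | v ≠ w}) G)) : J ∈ join ![G, singleVertex κ C] := by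
  classical
  let q : J.V → Fin 2 := fun v => if v = w then 1 else 0
  refine ⟨q, fun i => ?_⟩
  fin_cases i
  · have hs : {v | q v = 0} = {v | v ≠ w} := by
      ext v
      simp [q]
    change Nonempty (Iso (J.induce {v | q v = 0}) G)
    rw [hs]
    exact h
  · have hs : {v | q v = 1} = {v | v = w} := by
      ext v
      simp [q]
    change Nonempty (Iso (J.induce {v | q v = 1}) (singleVertex κ C))
    rw [hs]
    refine ⟨⟨⟨fun _ => (), fun _ => ⟨w, rfl⟩, fun v => Subtype.ext v.2.symm, fun _ => rfl⟩,
      fun e => ⟨fun h => h.elim, fun h => ?_⟩⟩⟩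
    obtain ⟨u, -, v, -, huv⟩ := exists_ne_of_mem_edges h
    exact absurd (Subtype.ext (u.2.trans v.2.symm)) huv

/-- A one-vertex extension `J` of `K` outside `P` is enlarged to a one-vertex extension of `H`:
edges through the new vertex come from `J`, all others from `H`. It contains `J`, so it is not in
`P` either. -/
theorem strict_of_isEmb {P : Set (DirHypergraph κ C)} (hP : IsAdditiveInducedHereditary P)
    {K H : DirHypergraph κ C} (hK : K ∈ strict P) {f : K.V → H.V} (hf : IsEmb f) (hH : H ∈ P) :
    H ∈ strict P := by
  classical
  obtain ⟨-, hK⟩ := hK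
  obtain ⟨J, hJ, hJP⟩ := Set.not_subset.1 hK
  obtain ⟨w, ⟨i⟩⟩ := exists_iso_of_mem_join_singleVertex hJ
  have := H.finite_vertices
  let ψ : J.V → Option H.V := fun v => if h : v = w then none else some (f (i.toEquiv ⟨v, h⟩))
  have ψw : ψ w = none := dif_pos rfl
  have ψs : ∀ v : {v // v ≠ w}, ψ v.1 = some (f (i.toEquiv v)) := fun v => dif_neg v.2
  have hψ : Function.Injective ψ := by
    intro u v huv
    by_cases hu : u = w <;> by_cases hv : v = w
    · rw [hu, hv]
    · rw [hu, ψw, ψs ⟨v, hv⟩] at huv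
      cases huv
    · rw [hv, ψw, ψs ⟨u, hu⟩] at huv
      cases huv
    · rw [ψs ⟨u, hu⟩, ψs ⟨v, hv⟩] at huv
      exact congrArg Subtype.val (i.toEquiv.injective (hf.1 (Option.some_inj.1 huv)))
  have hE := (H.isHyp.push (Option.some_injective _)).ite (J.isHyp.push hψ)
    (R := fun e => ∀ v ∈ e.1, v ≠ none) fun e e' h he v hv => he v ((h v).2 hv)
  have hemb : IsEmb (K := J) (H := ofEdges hE) ψ := by
    refine ⟨hψ, fun e => ?_⟩
    have hmem : e.map ψ ∈ HEdge.map ψ '' J.edges ↔ e ∈ J.edges :=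
      (HEdge.map_injective hψ).mem_set_image
    by_cases hr : ∀ v ∈ (e.map ψ).1, v ≠ none
    · have hw : ∀ v ∈ e.1, ∃ v' : {v // v ≠ w}, v'.1 = v := fun v hv =>
        ⟨⟨v, fun h => hr _ (List.mem_map_of_mem hv) (h ▸ ψw)⟩, rfl⟩
      obtain ⟨e', rfl⟩ := HEdge.exists_map_eq hw
      have h1 : HEdge.map ψ (HEdge.map Subtype.val e') =
          HEdge.map some (HEdge.map f (HEdge.map i.toEquiv e')) := by
        refine (HEdge.map_map _ _ _).trans ((HEdge.map_congr fun v _ => ψs v).trans ?_)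
        refine Eq.symm ((HEdge.map_map _ _ _).trans ?_)
        exact HEdge.map_map _ _ _
      have h2 : HEdge.map ψ (HEdge.map Subtype.val e') ∈ HEdge.map some '' H.edges ↔
          HEdge.map Subtype.val e' ∈ J.edges := by
        rw [h1, (HEdge.map_injective (Option.some_injective _)).mem_set_image, hf.2]
        exact i.mem_edges_iff e'
      exact ⟨fun h => h.elim (fun h => h2.1 h.2) fun h => absurd hr h.1,
        fun h => Or.inl ⟨hr, h2.2 h⟩⟩
    · exact ⟨fun h => h.elim (fun h => absurd h.1 hr) fun h => hmem.1 h.2,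
        fun h => Or.inr ⟨hr, hmem.2 h⟩⟩
  refine ⟨hH, fun hsub => hJP (hP.mem_of_isEmb hemb (hsub ?_))⟩
  refine mem_join_singleVertex (w := (none : Option H.V)) ⟨Iso.symm ⟨Equiv.ofBijective
    (fun v : H.V => (⟨some v, Option.some_ne_none v⟩ : {v : Option H.V // v ≠ none}))
    ⟨fun u v h => Option.some_inj.1 (congrArg Subtype.val h), ?_⟩, fun e => ?_⟩⟩
  · rintro ⟨_ | v, hv⟩
    · exact absurd rfl hv
    · exact ⟨v, rfl⟩
  · have h1 : HEdge.map some e ∈ HEdge.map some '' H.edges ↔ e ∈ H.edges :=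
      (HEdge.map_injective (Option.some_injective _)).mem_set_image
    have hr : ∀ v ∈ (HEdge.map some e).1, v ≠ none := fun v hv => by
      obtain ⟨x, -, rfl⟩ := List.mem_map.1 hv
      exact Option.some_ne_none x
    refine Iff.trans (b := HEdge.map some e ∈ (ofEdges hE).edges)
      (iff_of_eq (congrArg (· ∈ (ofEdges hE).edges) (HEdge.map_map _ Subtype.val e))) ?_
    exact ⟨fun h => h.elim (fun h => h1.1 h.2) fun h => absurd hr h.1,
      fun h => Or.inl ⟨hr, h1.2 h⟩⟩

/-- Every part of a decomposition meets every strict induced subhypergraph. -/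
theorem surjective_comp_of_strict {P : Set (DirHypergraph κ C)} {K G : DirHypergraph κ C}
    (hK : K ∈ strict P) {i : K.V → G.V} (hi : IsEmb i) {ρ : Type*} {D : G.V → ρ}
    (hD : Function.Surjective D) (hDP : Blow G D ⊆ P) : Function.Surjective (D ∘ i) := by
  classical
  intro j
  by_contra hj
  obtain ⟨v₀, rfl⟩ := hD j
  replace hj : ∀ u, D (i u) ≠ D v₀ := fun u hu => hj ⟨u, hu⟩
  obtain ⟨J, hJ, hJP⟩ := Set.not_subset.1 hK.2
  obtain ⟨w, ⟨s⟩⟩ := exists_iso_of_mem_join_singleVertex hJ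
  -- The extra vertex is placed in the missed part. It is alone in its class, so its edges are
  -- unconstrained and `J` becomes a blow-up of `G`.
  let φ : J.V → G.V := fun v => if h : v = w then v₀ else i (s.toEquiv ⟨v, h⟩)
  have φw : φ w = v₀ := dif_pos rfl
  have φs : ∀ v : {v // v ≠ w}, φ v.1 = i (s.toEquiv v) := fun v => dif_neg v.2
  have hDφ : ∀ v, D (φ v) = D v₀ → v = w := fun v hv => by
    by_contra h
    rw [φs ⟨v, h⟩] at hv
    exact hj _ hv
  refine hJP (hDP ⟨Unit, φ, fun _ => (), fun u v huv => ?_, fun e he => ?_⟩)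
  · replace huv : φ u = φ v := (Prod.mk.inj huv).1
    by_cases hu : u = w
    · rw [hu, φw] at huv
      rw [hu, hDφ v (congrArg D huv.symm)]
    · by_cases hv : v = w
      · rw [hv, φw] at huv
        rw [hv, hDφ u (congrArg D huv)]
      · rw [φs ⟨u, hu⟩, φs ⟨v, hv⟩] at huv
        exact congrArg Subtype.val (s.toEquiv.injective (hi.1 huv))
  · by_cases hw : w ∈ e.1
    · have hall : ∀ v ∈ e.1, v = w := fun v hv => hDφ v ((he v hv w hw).trans (congrArg D φw))
      constructor
      · intro h
        obtain ⟨u, hu, v, hv, huv⟩ := exists_ne_of_mem_edges h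
        exact absurd ((hall u hu).trans (hall v hv).symm) huv
      · rintro ⟨-, h⟩
        obtain ⟨u, hu, v, hv, huv⟩ := exists_ne_of_mem_edges h
        obtain ⟨u, hu', rfl⟩ := List.mem_map.1 hu
        obtain ⟨v, hv', rfl⟩ := List.mem_map.1 hv
        exact absurd (congrArg φ ((hall u hu').trans (hall v hv').symm)) huv
    · obtain ⟨e', rfl⟩ := HEdge.exists_map_eq (f := (Subtype.val : {v // v ≠ w} → J.V)) (e := e)
        fun v hv => ⟨⟨v, fun h => hw (h ▸ hv)⟩, rfl⟩
      have h1 : HEdge.map φ (HEdge.map Subtype.val e') =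
          HEdge.map i (HEdge.map s.toEquiv e') := by
        refine (HEdge.map_map _ _ _).trans ((HEdge.map_congr fun v _ => φs v).trans ?_)
        exact (HEdge.map_map _ _ _).symm
      rw [h1, hi.2]
      refine Iff.trans ?_ ((s.mem_edges_iff e').symm.trans ?_)
      · rfl
      · exact ⟨fun h => ⟨HEdge.ConstOn.of_const (fun _ => rfl) _, h⟩, And.right⟩

/-- The number of parts of a decomposition is at most the decomposability number of any strict
induced subhypergraph. -/
theorem card_le_decNumber {P : Set (DirHypergraph κ C)} (hP : IsAdditiveInducedHereditary P)
    {K G : DirHypergraph κ C} (hK : K ∈ strict P) {i : K.V → G.V} (hi : IsEmb i) {ρ : Type*}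
    [Finite ρ] {D : G.V → ρ} (hD : Function.Surjective D) (hDP : Blow G D ⊆ P) :
    Nat.card ρ ≤ decNumber P K := by
  have hsurj := surjective_comp_of_strict hK hi hD hDP
  let eq := Finite.equivFin ρ
  rw [decNumber, if_pos hK.1]
  refine le_csSup (bddAbove_parts P K) ⟨eq ∘ D ∘ i, (isDecomposition_iff hP).2
    ⟨eq.surjective.comp hsurj, ?_⟩⟩
  refine (blow_subset_of_refine (r := D ∘ i) fun u v h => congrArg eq h).trans ?_
  exact (blow_subset_of_isEmb hi).trans hDP

/-- A decomposition with the maximum number of parts is not properly refined. -/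
theorem eq_of_blow_prod_subset {P : Set (DirHypergraph κ C)} (hP : IsAdditiveInducedHereditary P)
    {K G : DirHypergraph κ C} (hK : K ∈ strict P) {i : K.V → G.V} (hi : IsEmb i) {ι : Type*}
    {p : G.V → ι} {f : G.V → Fin (decNumber P K)} (hf : Function.Surjective f)
    (hPf : Blow G (fun v => (p v, f v)) ⊆ P) {u v : G.V} (huv : f u = f v) : p u = p v := by
  have := G.finite_vertices
  -- The non-empty classes of the common refinement form a decomposition, so there are no more of
  -- them than classes of `f`.
  let r : G.V → Set.range fun v => (p v, f v) := fun v => ⟨_, v, rfl⟩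
  have hcard := card_le_decNumber hP hK hi (D := r) (fun ⟨_, v, hv⟩ => ⟨v, Subtype.ext hv⟩)
    ((blow_subset_of_refine fun u v h => Subtype.ext h).trans hPf)
  have hs : Function.Surjective fun x : Set.range (fun v => (p v, f v)) => x.1.2 := fun j => by
    obtain ⟨v, rfl⟩ := hf j
    exact ⟨r v, rfl⟩
  have hb := hs.bijective_of_nat_card_le (by simpa using hcard)
  have : r u = r v := hb.1 huv
  exact congrArg (fun x => x.1.1) this

/-- `G` contains `K`, hence is strict. Minimality of `K` bounds the maximal number of parts from
below and `card_le_decNumber` bounds it from above. Positivity is needed because `sSup ∅ = 0` would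
leave no decomposition to pick. -/
theorem exists_decomposition {P : Set (DirHypergraph κ C)} (hP : IsAdditiveInducedHereditary P)
    {K G : DirHypergraph κ C} (hK : K ∈ strict P)
    (hmin : ∀ H ∈ strict P, decNumber P K ≤ decNumber P H) (hpos : 0 < decNumber P K)
    {i : K.V → G.V} (hi : IsEmb i) (hG : G ∈ P) :
    ∃ D : G.V → Fin (decNumber P K), Function.Surjective D ∧ Blow G D ⊆ P := by
  have hle := hmin G (strict_of_isEmb hP hK hi hG)
  have hdef : decNumber P G = sSup {n : ℕ | ∃ p : G.V → Fin n, IsDecomposition P G p} := by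
    rw [decNumber, if_pos hG]
  have hne : {n : ℕ | ∃ p : G.V → Fin n, IsDecomposition P G p}.Nonempty := by
    rw [Set.nonempty_iff_ne_empty]
    intro h
    rw [h] at hdef
    simp at hdef
    omega
  obtain ⟨k, hk, D, hD⟩ : ∃ k, decNumber P K ≤ k ∧ ∃ D : G.V → Fin k, IsDecomposition P G D :=
    ⟨_, hdef ▸ hle, Nat.sSup_mem hne (bddAbove_parts P G)⟩
  rw [isDecomposition_iff hP] at hD
  have hk' := card_le_decNumber hP hK hi hD.1 hD.2
  rw [Nat.card_fin] at hk'
  obtain rfl := hk'.antisymm hk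
  exact ⟨D, hD⟩

/-! ### Uniform partitions from the Ramsey theorem -/

theorem isEmb_sigmaMk {ι : Type} [Finite ι] (G : ι → DirHypergraph κ C) (o : ι) :
    IsEmb (K := G o) (H := disjUnion G) (fun v => ⟨o, v⟩) := by
  have hinj : Function.Injective (Sigma.mk (β := fun i => (G i).V) o) := sigma_mk_injective
  refine ⟨hinj, fun e => ⟨?_, fun h => ⟨o, e, h, rfl⟩⟩⟩
  rintro ⟨j, f, hf, h⟩
  by_cases hne : ∃ v, v ∈ e.1
  · obtain ⟨v, hv⟩ := hne
    have hv' : (⟨o, v⟩ : Σ i, (G i).V) ∈ (HEdge.map (Sigma.mk j) f).1 := h ▸ List.mem_map_of_mem hv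
    obtain ⟨x, -, hx⟩ := List.mem_map.1 hv'
    obtain rfl : j = o := congrArg Sigma.fst hx
    exact HEdge.map_injective hinj h ▸ hf
  · have h0 : e.1 = [] := List.eq_nil_iff_forall_not_mem.2 fun v hv => hne ⟨v, hv⟩
    have h1 := congrArg List.length (Prod.mk.inj h).1
    have := (G j).two_le f hf
    simp [h0] at h1
    rw [h1] at this
    exact absurd this (by decide : ¬ 2 ≤ 0)

theorem IsBlow.mem_blow_induce {G T : DirHypergraph κ C} {ι : Type*} {p : G.V → ι} {β : Type}
    {φ : T.V → G.V} {b : T.V → β} (h : IsBlow p φ b) {U : Set G.V} (hU : ∀ v, φ v ∈ U) :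
    T ∈ Blow (G.induce U) (fun v => p v.1) := by
  refine ⟨β, fun v => ⟨φ v, hU v⟩, b, fun u v huv => ?_, fun e he => ?_⟩
  · exact h.inj (Prod.ext (congrArg Subtype.val (Prod.mk.inj huv).1) (Prod.mk.inj huv).2)
  · rw [h.mem_iff e he]
    exact and_congr_right fun _ => iff_of_eq (congrArg (· ∈ G.edges)
      (HEdge.map_map (fun v => (⟨φ v, hU v⟩ : U)) Subtype.val e).symm)

theorem exists_isBlow_of_mem_blow_induce {G T : DirHypergraph κ C} {ι : Type*} {p : G.V → ι}
    {U : Set G.V} (h : T ∈ Blow (G.induce U) (fun v => p v.1)) :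
    ∃ (β : Type) (φ : T.V → G.V) (b : T.V → β), IsBlow p φ b ∧ ∀ v, φ v ∈ U := by
  obtain ⟨β, φ, b, hb⟩ := h
  exact ⟨β, fun v => (φ v).1, b, IsBlow.map_isEmb (p := p) (isEmb_val G U) hb, fun v => (φ v).2⟩

/-- If all blow-ups of `G` have a partition into parts with properties `Q l`, then `G` has a
partition all of whose blow-ups are compatible with the `Q l`. -/
theorem exists_colouring_of_blow_subset_product {G : DirHypergraph κ C} {ι : Type} {m : ℕ}
    {Q : Fin m → Set (DirHypergraph κ C)} (hQ : ∀ l, IsAdditiveInducedHereditary (Q l))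
    {p : G.V → ι} (h : Blow G p ⊆ product Q) :
    ∃ f : G.V → Fin m, ∀ l, Blow (G.part f l) (fun v => p v.1) ⊆ Q l := by
  -- The Ramsey theorem needs at least one colour.
  obtain rfl | hm := Nat.eq_zero_or_pos m
  · obtain ⟨χ, -⟩ := h (mem_blow_self G p)
    exact ⟨χ, fun l => l.elim0⟩
  have : Nonempty (Fin m) := ⟨⟨0, hm⟩⟩
  by_contra! hbad
  choose l hl using hbad
  -- Each colouring `f` has a bad blow-up `T f` on its colour class `l f`. The Ramsey theorem finds
  -- some `T f` as an induced subhypergraph in colour `l f` of a member of the product.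
  choose T hT hTQ using fun f => Set.not_subset.1 (hl f)
  choose β φ b hb hφ using fun f => exists_isBlow_of_mem_blow_induce (hT f)
  obtain ⟨H, β', φH, bH, hH, hχ⟩ := exists_blow_ramsey G p T φ fun f =>
    ⟨β f, b f, (hb f).of_refine fun u v huv => congrArg Prod.fst huv⟩
  obtain ⟨χ, hχQ⟩ := h ⟨β', φH, bH, hH⟩
  obtain ⟨f, ⟨g, hg, hgc, hge⟩, -⟩ := hχ χ
  have hemb : IsEmb g := ⟨hg, fun e => hge e (HEdge.ConstOn.of_const (hφ f) e)⟩
  exact hTQ f ((hQ (l f)).mem_of_isEmb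
    (hemb.codRestrict (U := {v | χ v = l f}) fun v => (hgc v).trans (hφ f v)) (hχQ (l f)))

/-- Some blow-up `H` of `G` is such that every decomposition of `H` induces, on some copy of `G`,
a partition whose common refinement with `p` is still compatible with `P`. -/
theorem exists_blow_forall_decomposition (G : DirHypergraph κ C) {ι γ : Type} [Finite γ]
    [Nonempty γ] (P : Set (DirHypergraph κ C)) (p : G.V → ι) :
    ∃ (H : DirHypergraph κ C) (β : Type) (φ : H.V → G.V) (b : H.V → β), IsBlow p φ b ∧
      (∃ i : G.V → H.V, IsEmb i) ∧ ∀ D : H.V → γ, Blow H D ⊆ P →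
        ∃ i : G.V → H.V, IsEmb i ∧ (∀ v, φ (i v) = v) ∧
          Blow G (fun v => (p v, D (i v))) ⊆ P := by
  -- `T f` tests whether the refinement `(p, f)` is compatible with `P`: it is a counterexample if
  -- one exists, and `G` otherwise.
  have key : ∀ f : G.V → γ, ∃ (T : DirHypergraph κ C) (φ : T.V → G.V),
      (∃ (β : Type) (b : T.V → β), IsBlow (fun v => (p v, f v)) φ b) ∧
        (T ∈ P → Blow G (fun v => (p v, f v)) ⊆ P) := by
    intro f
    by_cases hf : Blow G (fun v => (p v, f v)) ⊆ P
    · exact ⟨G, id, ⟨_, _, isBlow_id G _⟩, fun _ => hf⟩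
    · obtain ⟨T, ⟨β, φ, b, hb⟩, hTP⟩ := Set.not_subset.1 hf
      exact ⟨T, φ, ⟨β, b, hb⟩, fun h => absurd h hTP⟩
  choose T φ hT hTP using key
  obtain ⟨H, β, φH, b, hb, hχ⟩ := exists_blow_ramsey G p T φ hT
  refine ⟨H, β, φH, b, hb, ?_, fun D hD => ?_⟩
  · obtain ⟨-, -, i, hi, -⟩ := hχ fun _ => Classical.arbitrary γ
    exact ⟨i, hi⟩
  · obtain ⟨f, ⟨g, hg, hgc, hge⟩, i, hi, hφi, hif⟩ := hχ D
    obtain rfl : (fun v => D (i v)) = f := funext hif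
    -- The copy of `T f` need not be induced: its edges are right inside the classes of `D`, and a
    -- blow-up of `H` prescribes no others. So `T f` is a one-block blow-up of `H`.
    refine ⟨i, hi, hφi, hTP _ (hD ⟨Unit, g, fun _ => (), ?_, fun e he => ?_⟩)⟩
    · exact fun u v huv => hg (Prod.mk.inj huv).1
    · rw [hge e fun u hu v hv => ?_]
      · exact ⟨fun h => ⟨HEdge.ConstOn.of_const (fun _ => rfl) e, h⟩, And.right⟩
      · have := he u hu v hv
        simp only [Function.comp_apply, hgc] at this
        exact this

/-! ### Existence of strict hypergraphs -/

theorem exists_not_mem_of_strict {Q : Set (DirHypergraph κ C)} {G : DirHypergraph κ C}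
    (h : G ∈ strict Q) : ∃ F, F ∉ Q := by
  obtain ⟨J, -, hJ⟩ := Set.not_subset.1 h.2
  exact ⟨J, hJ⟩

/-- A product of properties that omit some hypergraph omits some hypergraph. -/
theorem exists_not_mem_product {m : ℕ} {Q : Fin m → Set (DirHypergraph κ C)}
    (hQ : ∀ l, IsAdditiveInducedHereditary (Q l)) (h : ∀ l, ∃ F, F ∉ Q l) :
    ∃ F, F ∉ product Q := by
  by_contra! hall
  choose F hF using h
  have := fun l => (F l).finite_vertices
  let G : DirHypergraph κ C := ofEdges (V := ∀ l, (F l).V) IsHyp.empty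
  -- With `p = id` all classes are singletons, so any hypergraph on a subset of the vertices of `G`
  -- is a blow-up.
  obtain ⟨f, hf⟩ := exists_colouring_of_blow_subset_product (G := G) (p := id) hQ
    fun T _ => hall T
  -- Diagonal argument: if every `l` missed a value `a l`, the vertex `a` of the product would
  -- realise the value missed by its own colour.
  have hl : ∃ l, ∀ a : (F l).V, ∃ v : ∀ l, (F l).V, f v = l ∧ v l = a := by
    by_contra! hne
    choose a ha using hne
    exact ha (f a) a rfl rfl
  obtain ⟨l, hl⟩ := hl
  choose s hsf hsl using hl
  have hs : Function.Injective s := fun u v huv => by rw [← hsl u, ← hsl v, huv]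
  have hblow : IsBlow (G := G) (H := F l) id s (fun _ => ()) := by
    refine ⟨fun u v huv => hs (Prod.mk.inj huv).1, fun e he => ⟨fun h => ?_, fun h => h.2.elim⟩⟩
    obtain ⟨u, hu, v, hv, huv⟩ := exists_ne_of_mem_edges h
    exact absurd (hs (he u hu v hv)) huv
  exact hF l (hf l (hblow.mem_blow_induce hsf))

/-- Deleting a vertex from a smallest hypergraph outside `P` leaves a strict one. -/
theorem exists_strict {P : Set (DirHypergraph κ C)} (hP : IsAdditiveInducedHereditary P)
    (h : ∃ F, F ∉ P) : ∃ G, G ∈ strict P := by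
  classical
  have hex : ∃ k, ∃ F, F ∉ P ∧ Nat.card F.V = k := by
    obtain ⟨F, hF⟩ := h
    exact ⟨_, F, hF, rfl⟩
  obtain ⟨F, hF, hcard⟩ := Nat.find_spec hex
  have := F.finite_vertices
  obtain hemp | ⟨⟨w⟩⟩ := isEmpty_or_nonempty F.V
  · exact absurd (hP.mem_of_isEmpty F) hF
  refine ⟨F.induce {v | v ≠ w}, ?_, fun hsub => hF (hsub (mem_join_singleVertex (w := w) ?_))⟩
  · by_contra hnot
    refine Nat.find_min hex (m := Nat.card {v // v ≠ w}) ?_ ⟨_, hnot, rfl⟩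
    rw [← hcard]
    exact Finite.card_subtype_lt (x := w) (by simp)
  · exact ⟨⟨Equiv.refl _, fun e => iff_of_eq (congrArg _ (HEdge.map_id e))⟩⟩

theorem exists_decNumber_eq_one {Q : Set (DirHypergraph κ C)} (h : IsIndecomposable Q) :
    ∃ G ∈ strict Q, decNumber Q G = 1 := by
  by_contra! hne
  have h1 : ∀ G ∈ strict Q, (1 : ℕ∞) ≤ decNumber Q G := fun G hG =>
    (le_of_eq h.symm).trans (iInf₂_le G hG)
  have h2 : (2 : ℕ∞) ≤ dec Q := le_iInf₂ fun G hG => by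
    have h3 : 1 ≤ decNumber Q G := by exact_mod_cast h1 G hG
    have := hne G hG
    have : 2 ≤ decNumber Q G := by omega
    exact_mod_cast this
  rw [h] at h2
  exact absurd h2 (by decide)

theorem nonempty_of_decNumber_eq_one {Q : Set (DirHypergraph κ C)} {G : DirHypergraph κ C}
    (hG : G ∈ Q) (h : decNumber Q G = 1) : Nonempty G.V := by
  rw [decNumber, if_pos hG] at h
  have hne : {n : ℕ | ∃ p : G.V → Fin n, IsDecomposition Q G p}.Nonempty := by
    rw [Set.nonempty_iff_ne_empty]
    intro h0
    simp [h0] at h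
  obtain ⟨p, hp, -⟩ := Nat.sSup_mem hne (bddAbove_parts Q G)
  obtain ⟨v, -⟩ := hp ⟨0, by omega⟩
  exact ⟨v⟩

/-! ### Assignments of parts to factors -/

/-- The assignments of the parts of `p` to the properties `Q l` that are compatible with all
blow-ups. -/
def assignments {m n : ℕ} (Q : Fin m → Set (DirHypergraph κ C)) (G : DirHypergraph κ C)
    (p : G.V → Fin n) : Set (Fin n → Fin m) :=
  {c | ∀ l, Blow (G.part (c ∘ p) l) (fun v => p v.1) ⊆ Q l}

/-- Enlarging a decomposed hypergraph can only destroy assignments; this makes a minimal number of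
them stable under extension. -/
theorem assignments_subset_of_isEmb {m n : ℕ} (Q : Fin m → Set (DirHypergraph κ C))
    {K G : DirHypergraph κ C} (p : G.V → Fin n) {i : K.V → G.V} (hi : IsEmb i) :
    assignments Q G p ⊆ assignments Q K (p ∘ i) := fun c hc l => by
  have hi' : IsEmb (K := K.part (c ∘ p ∘ i) l) (H := G.part (c ∘ p) l)
      (fun v => (⟨i v.1, v.2⟩ : {v | c (p v) = l})) :=
    (hi.comp (isEmb_val K {v | c (p (i v)) = l})).codRestrict (U := {v | c (p v) = l})
      fun v => v.2
  exact (blow_subset_of_isEmb (G := G.part (c ∘ p) l) (p := fun v => p v.1) hi').trans (hc l)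

/-- The colouring induced by the factorisation refines `p` to another decomposition. As `p` already
has the maximal number of parts, the colouring is constant on them and factors through `p`. -/
theorem assignments_nonempty {m : ℕ} {P : Set (DirHypergraph κ C)}
    (hP : IsAdditiveInducedHereditary P) {Q : Fin m → Set (DirHypergraph κ C)}
    (hQ : ∀ l, IsAdditiveInducedHereditary (Q l)) (hfac : P = product Q)
    {K G : DirHypergraph κ C} (hK : K ∈ strict P) {i : K.V → G.V} (hi : IsEmb i)
    {p : G.V → Fin (decNumber P K)} (hp : Function.Surjective p) (hpP : Blow G p ⊆ P) :
    (assignments Q G p).Nonempty := by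
  obtain ⟨f, hf⟩ := exists_colouring_of_blow_subset_product hQ (hpP.trans hfac.subset)
  have hprod : Blow G (fun v => (f v, p v)) ⊆ P := by
    rintro T ⟨β, φ, b, hb⟩
    rw [hfac]
    refine ⟨f ∘ φ, fun l => hf l ?_⟩
    have hT : IsBlow (H := T.part (f ∘ φ) l) (fun v => (f v, p v)) (fun v => φ v.1)
      (fun v => b v.1) := hb.comp_isEmb (isEmb_val T _)
    exact blow_subset_of_refine (G := G.part f l) (p := fun v => (f v.1, p v.1))
      (r := fun v => p v.1) (fun u v h => Prod.ext (u.2.trans v.2.symm) h)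
      (hT.mem_blow_induce (U := {v | f v = l}) fun v => v.2)
  have hc : (f ∘ Function.surjInv hp) ∘ p = f := funext fun v =>
    eq_of_blow_prod_subset hP hK hi hp hprod (Function.surjInv_eq hp (p v))
  refine ⟨f ∘ Function.surjInv hp, fun l => ?_⟩
  rw [hc]
  exact hf l

theorem IsEmb.lift_sigma {ι : Type} [Finite ι] {F : ι → DirHypergraph κ C}
    {K : DirHypergraph κ C} {s : K.V → (disjUnion F).V} (hs : IsEmb s) {o : ι}
    (ho : ∀ v, (s v).1 = o) : ∃ t : K.V → (F o).V, IsEmb t ∧ ∀ v, s v = ⟨o, t v⟩ := by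
  have : ∀ v, ∃ x, s v = ⟨o, x⟩ := fun v => by
    obtain rfl := ho v
    exact ⟨(s v).2, rfl⟩
  choose t ht using this
  obtain rfl : s = fun v => ⟨o, t v⟩ := funext ht
  refine ⟨t, ⟨fun u v h => hs.1 (congrArg (Sigma.mk o) h), fun e => ?_⟩, fun v => rfl⟩
  rw [← hs.2, ← (isEmb_sigmaMk F o).2]
  exact iff_of_eq (congrArg (· ∈ (disjUnion F).edges) (HEdge.map_map _ _ _))

/-- A decomposed hypergraph with an assignment extends to one in which the part assigned to `Q l`
contains a given member of `Q l`. -/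
theorem exists_extension {m : ℕ} {P : Set (DirHypergraph κ C)}
    (hP : IsAdditiveInducedHereditary P) {Q : Fin m → Set (DirHypergraph κ C)}
    (hQ : ∀ l, IsAdditiveInducedHereditary (Q l)) (hfac : P = product Q)
    {K G : DirHypergraph κ C} (hK : K ∈ strict P)
    (hmin : ∀ H ∈ strict P, decNumber P K ≤ decNumber P H) (hpos : 0 < decNumber P K)
    {i₀ : K.V → G.V} (hi₀ : IsEmb i₀) {p : G.V → Fin (decNumber P K)}
    (hp : Function.Surjective p) {c : Fin (decNumber P K) → Fin m}
    (hc : c ∈ assignments Q G p) (X : Fin m → DirHypergraph κ C) (hX : ∀ l, X l ∈ Q l) :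
    ∃ (G' : DirHypergraph κ C) (p' : G'.V → Fin (decNumber P K)) (i : G.V → G'.V), IsEmb i ∧
      p' ∘ i = p ∧ Function.Surjective p' ∧ Blow G' p' ⊆ P ∧
      ∀ l, ∃ x : (X l).V → G'.V, IsEmb x ∧ ∀ v, c (p' (x v)) = l := by
  have : Nonempty (Fin (decNumber P K)) := ⟨⟨0, hpos⟩⟩
  obtain ⟨H, βH, φ, bH, hH, ⟨j, hj⟩, hHD⟩ :=
    exists_blow_forall_decomposition (γ := Fin (decNumber P K)) G P p
  let F : Option (Fin m) → DirHypergraph κ C := fun o => o.elim H X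
  -- `q` records the intended factor: the one given by `c` on the blow-up `H` of `G`, and `l` on `X
  -- l`.
  let q : (disjUnion F).V → Fin m := fun v => match v with
    | ⟨none, v⟩ => c (p (φ v))
    | ⟨some l, _⟩ => l
  let inl : H.V → (disjUnion F).V := fun v => ⟨none, v⟩
  have hinl : IsEmb inl := isEmb_sigmaMk F none
  have hqP : Blow (disjUnion F) q ⊆ P := by
    rintro T ⟨β, ψ, b, hb⟩
    rw [hfac]
    refine ⟨q ∘ ψ, fun l => ?_⟩
    have hT : ∀ e : HEdge C (T.part (q ∘ ψ) l).V, e ∈ (T.part (q ∘ ψ) l).edges ↔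
        HEdge.ConstOn (fun v => b v.1) e ∧ e.map (fun v => ψ v.1) ∈ (disjUnion F).edges :=
      fun e => (hb.comp_isEmb (isEmb_val T {v | q (ψ v) = l})).mem_iff e
        (HEdge.ConstOn.of_const (fun v => v.2) e)
    -- The part for `Q l` splits by block and by summand. Pieces from `H` are in `Q l` because `c`
    -- is an assignment; the other non-empty pieces are induced in `X l`.
    refine (hQ l).mem_of_fibers _ (fun v => (b v.1, (ψ v.1).1)) (fun e he => ?_) ?_
    · obtain ⟨h1, o, f, -, hf⟩ := (hT e).1 he
      have h2 : ∀ v ∈ e.1, (ψ v.1).1 = o := fun v hv => by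
        have : ψ v.1 ∈ (HEdge.map (Sigma.mk o) f).1 :=
          hf ▸ List.mem_map_of_mem (f := fun v : (T.part (q ∘ ψ) l).V => ψ v.1) hv
        obtain ⟨x, -, hx⟩ := List.mem_map.1 this
        rw [← hx]
      exact fun u hu v hv => Prod.ext (h1 u hu v hv) ((h2 u hu).trans (h2 v hv).symm)
    · rintro ⟨b₀, o⟩
      let N := (T.part (q ∘ ψ) l).induce {v | (b v.1, (ψ v.1).1) = (b₀, o)}
      have hN : IsEmb (K := N) (H := disjUnion F) (fun v => ψ v.1.1) := by
        refine ⟨fun u v huv => ?_, fun e => ?_⟩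
        · have h1 : b u.1.1 = b v.1.1 := (Prod.mk.inj u.2).1.trans (Prod.mk.inj v.2).1.symm
          exact Subtype.ext (Subtype.ext (hb.inj (Prod.ext huv h1)))
        · have hval : IsEmb (K := N) (H := T.part (q ∘ ψ) l) Subtype.val := isEmb_val _ _
          rw [← hval.2 e, hT]
          have h1 : HEdge.ConstOn (fun v => b v.1) (HEdge.map (Subtype.val : N.V → _) e) :=
            (HEdge.constOn_map _ _ _).2
              (HEdge.ConstOn.of_const (fun v => (Prod.mk.inj v.2).1) e)
          refine Iff.trans ?_ (and_iff_right h1).symm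
          exact iff_of_eq (congrArg (· ∈ (disjUnion F).edges)
            (HEdge.map_map Subtype.val (fun v : (T.part (q ∘ ψ) l).V => ψ v.1) e).symm)
      obtain ⟨t, ht, hst⟩ := hN.lift_sigma fun v => (Prod.mk.inj v.2).2
      have hqN : ∀ v : N.V, q ⟨o, t v⟩ = l := fun v => (congrArg q (hst v)).symm.trans v.1.2
      change N ∈ Q l
      cases o with
      | none => exact hc l ((hH.comp_isEmb ht).mem_blow_induce (U := {v | c (p v) = l}) hqN)
      | some l' =>
        obtain hemp | ⟨⟨v⟩⟩ := isEmpty_or_nonempty N.V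
        · exact (hQ l).mem_of_isEmpty N
        · obtain rfl : l' = l := hqN v
          exact (hQ l').mem_of_isEmb ht (hX l')
  obtain ⟨H', βH', φ', bH', hH', ⟨j', hj'⟩, hHD'⟩ :=
    exists_blow_forall_decomposition (γ := Fin (decNumber P K)) (disjUnion F) P q
  have hK' : IsEmb (inl ∘ j ∘ i₀) := hinl.comp (hj.comp hi₀)
  obtain ⟨D, hD, hDP⟩ := exists_decomposition hP hK hmin hpos (hj'.comp hK')
    (hqP ⟨βH', φ', bH', hH'⟩)
  obtain ⟨i', hi', -, hqf⟩ := hHD' D hDP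
  let f : (disjUnion F).V → Fin (decNumber P K) := fun v => D (i' v)
  have hf : Function.Surjective f := fun k => by
    obtain ⟨v, hv⟩ := surjective_comp_of_strict hK (hi'.comp hK') hD hDP k
    exact ⟨_, hv⟩
  have hfP : Blow (disjUnion F) f ⊆ P :=
    (blow_subset_of_refine fun u v h => congrArg Prod.snd h).trans hqf
  -- `(q, f)` is compatible with `P` and `f` has the maximal number of parts, so `f` refines `q`.
  have hfq : ∀ u v, f u = f v → q u = q v := fun u v =>
    eq_of_blow_prod_subset hP hK hK' hf hqf
  -- The choice of `H` gives a copy of `G` on which `f` and `p` have a common refinement compatible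
  -- with `P`. Both have the maximal number of parts, so they agree there up to a permutation `σ`.
  obtain ⟨i, hi, hφi, hpf⟩ := hHD (f ∘ inl) ((blow_subset_of_isEmb hinl).trans hfP)
  let h : G.V → Fin (decNumber P K) := fun v => f (inl (i v))
  have hh : Function.Surjective h := fun k => by
    obtain ⟨v, hv⟩ := surjective_comp_of_strict hK (hinl.comp (hi.comp hi₀)) hf hfP k
    exact ⟨_, hv⟩
  have hhp : ∀ u v, h u = h v → p u = p v := fun u v =>
    eq_of_blow_prod_subset hP hK hi₀ hh hpf
  have hph : ∀ u v, p u = p v → h u = h v := fun u v =>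
    eq_of_blow_prod_subset hP hK hi₀ hp ((blow_subset_of_refine fun u v huv =>
      Prod.ext (congrArg Prod.snd huv) (congrArg Prod.fst huv)).trans hpf)
  let σ₀ : Fin (decNumber P K) → Fin (decNumber P K) := h ∘ Function.surjInv hp
  have hσ₀ : ∀ v, σ₀ (p v) = h v := fun v => hph _ _ (Function.surjInv_eq hp (p v))
  have hσinj : Function.Injective σ₀ := fun k l hkl => by
    have := hhp _ _ hkl
    rwa [Function.surjInv_eq hp, Function.surjInv_eq hp] at this
  let σ : Fin (decNumber P K) ≃ Fin (decNumber P K) :=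
    Equiv.ofBijective σ₀ (Finite.injective_iff_bijective.1 hσinj)
  have hpi : ∀ v, σ.symm (f (inl (i v))) = p v := fun v =>
    (Equiv.symm_apply_eq σ).2 (hσ₀ v).symm
  -- The copy of `G` meets every part of `f`, and `q` is constant on those parts, so it suffices to
  -- compare on the copy.
  have hcq : ∀ u, c (σ.symm (f u)) = q u := fun u => by
    obtain ⟨g, hg⟩ := hp (σ.symm (f u))
    have h1 : f (inl (i g)) = f u := σ.symm.injective ((hpi g).trans hg)
    rw [← hfq _ _ h1, ← hg]
    exact congrArg (fun v => c (p v)) (hφi g).symm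
  refine ⟨disjUnion F, σ.symm ∘ f, inl ∘ i, hinl.comp hi, funext hpi, σ.symm.surjective.comp hf,
    (blow_subset_of_refine fun u v huv => congrArg σ.symm huv).trans hfP,
    fun l => ⟨fun v => ⟨some l, v⟩, isEmb_sigmaMk F (some l), fun v => hcq _⟩⟩

/-! ### The two inequalities -/

theorem le_decNumber {m : ℕ} {P : Set (DirHypergraph κ C)}
    (hP : IsAdditiveInducedHereditary P) {Q : Fin m → Set (DirHypergraph κ C)}
    (hQ : ∀ l, IsAdditiveInducedHereditary (Q l)) (hfac : P = product Q)
    (hne : ∀ l, ∃ X ∈ Q l, Nonempty X.V) {G : DirHypergraph κ C} (hG : G ∈ strict P) :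
    m ≤ decNumber P G := by
  obtain ⟨χ, hχ⟩ : G ∈ product Q := hfac ▸ hG.1
  have hsub : Blow G χ ⊆ P := by
    rintro T ⟨β, φ, b, hb⟩
    rw [hfac]
    refine ⟨χ ∘ φ, fun l => ?_⟩
    have hT : ∀ e : HEdge C (T.part (χ ∘ φ) l).V, e ∈ (T.part (χ ∘ φ) l).edges ↔
        HEdge.ConstOn (fun v => b v.1) e ∧ e.map (fun v => φ v.1) ∈ G.edges :=
      fun e => (hb.comp_isEmb (isEmb_val T {v | χ (φ v) = l})).mem_iff e
        (HEdge.ConstOn.of_const (fun v => v.2) e)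
    refine (hQ l).mem_of_fibers _ (fun v => b v.1) (fun e he => ((hT e).1 he).1) fun b₀ => ?_
    let N := (T.part (χ ∘ φ) l).induce {v | b v.1 = b₀}
    have hN : IsEmb (K := N) (H := G) (fun v => φ v.1.1) := by
      refine ⟨fun u v huv => ?_, fun e => ?_⟩
      · exact Subtype.ext (Subtype.ext (hb.inj (Prod.ext huv (u.2.trans v.2.symm))))
      · have hval : IsEmb (K := N) (H := T.part (χ ∘ φ) l) Subtype.val := isEmb_val _ _
        rw [← hval.2 e, hT]
        have h1 : HEdge.ConstOn (fun v => b v.1) (HEdge.map (Subtype.val : N.V → _) e) :=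
          (HEdge.constOn_map _ _ _).2 (HEdge.ConstOn.of_const (fun v => v.2) e)
        refine Iff.trans ?_ (and_iff_right h1).symm
        exact iff_of_eq (congrArg (· ∈ G.edges)
          (HEdge.map_map Subtype.val (fun v : (T.part (χ ∘ φ) l).V => φ v.1) e).symm)
    exact (hQ l).mem_of_isEmb (hN.codRestrict (U := {v | χ v = l}) fun v => v.1.2) (hχ l)
  have hsurj : Function.Surjective χ := by
    classical
    intro l
    by_contra hl
    refine hG.2 fun J hJ => ?_
    obtain ⟨w, ⟨s⟩⟩ := exists_iso_of_mem_join_singleVertex hJ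
    -- The extra vertex goes into the empty part `l`. The one-vertex hypergraph is in `Q l` because
    -- `Q l` has a non-empty member.
    let χ' : J.V → Fin m := fun v => if h : v = w then l else χ (s.toEquiv ⟨v, h⟩)
    have χw : χ' w = l := dif_pos rfl
    have χs : ∀ v (h : v ≠ w), χ' v = χ (s.toEquiv ⟨v, h⟩) := fun v h => dif_neg h
    rw [hfac]
    refine ⟨χ', fun l' => ?_⟩
    by_cases hll : l' = l
    · subst hll
      obtain ⟨X, hX, ⟨x⟩⟩ := hne l'
      have hw : ∀ v : (J.part χ' l').V, v.1 = w := fun v => by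
        by_contra h
        exact hl ⟨_, (χs _ h).symm.trans v.2⟩
      refine (hQ l').mem_of_isEmb (f := fun _ => x) ⟨fun u v _ => Subtype.ext
        ((hw u).trans (hw v).symm), fun e => ⟨fun h => ?_, fun h => ?_⟩⟩ hX
      · obtain ⟨u, hu, v, hv, huv⟩ := exists_ne_of_mem_edges h
        obtain ⟨u, -, rfl⟩ := List.mem_map.1 hu
        obtain ⟨v, -, rfl⟩ := List.mem_map.1 hv
        exact absurd rfl huv
      · obtain ⟨u, -, v, -, huv⟩ := exists_ne_of_mem_edges h
        exact absurd (Subtype.ext ((hw u).trans (hw v).symm)) huv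
    · have hw : ∀ v : (J.part χ' l').V, v.1 ≠ w := fun v h => hll (by
        rw [← χw, ← h]
        exact v.2.symm)
      have h1 : IsEmb (K := J.part χ' l') (H := J.induce {v | v ≠ w})
          (fun v => ⟨v.1, hw v⟩) := (isEmb_val J {v | χ' v = l'}).codRestrict (U := {v | v ≠ w}) hw
      exact (hQ l').mem_of_isEmb ((s.isEmb.comp h1).codRestrict (U := {v | χ v = l'})
        fun v => (χs _ (hw v)).symm.trans v.2) (hχ l')
  rw [decNumber, if_pos hG.1]
  exact le_csSup (bddAbove_parts P G) ⟨χ, (isDecomposition_iff hP).2 ⟨hsurj, hsub⟩⟩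

theorem exists_strict_decNumber_le {m : ℕ} {P : Set (DirHypergraph κ C)}
    (hP : IsAdditiveInducedHereditary P) {Q : Fin m → Set (DirHypergraph κ C)}
    (hQ : ∀ l, IsAdditiveInducedHereditary (Q l)) (hfac : P = product Q)
    (X : Fin m → DirHypergraph κ C) (hX : ∀ l, X l ∈ strict (Q l))
    (hX1 : ∀ l, decNumber (Q l) (X l) = 1) : ∃ K ∈ strict P, decNumber P K ≤ m := by
  classical
  obtain ⟨K₀, hK₀⟩ := exists_strict hP
    (hfac ▸ exists_not_mem_product hQ fun l => exists_not_mem_of_strict (hX l))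
  obtain ⟨K, hK, hmin⟩ : ∃ K ∈ strict P, ∀ H ∈ strict P, decNumber P K ≤ decNumber P H := by
    have hex : ∃ k, ∃ K ∈ strict P, decNumber P K = k := ⟨_, K₀, hK₀, rfl⟩
    obtain ⟨K, hK, hk⟩ := Nat.find_spec hex
    exact ⟨K, hK, fun H hH => hk ▸ Nat.find_min' hex ⟨H, hH, rfl⟩⟩
  refine ⟨K, hK, ?_⟩
  obtain h0 | hpos := Nat.eq_zero_or_pos (decNumber P K)
  · omega
  let S : Set ℕ := {k | ∃ (G : DirHypergraph κ C) (p : G.V → Fin (decNumber P K))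
    (i : K.V → G.V), IsEmb i ∧ Function.Surjective p ∧ Blow G p ⊆ P ∧
    (assignments Q G p).ncard = k}
  have hid : IsEmb (id : K.V → K.V) :=
    ⟨Function.injective_id, fun e => iff_of_eq (congrArg (· ∈ K.edges) (HEdge.map_id e))⟩
  obtain ⟨D, hD, hDP⟩ := exists_decomposition hP hK hmin hpos hid hK.1
  have hex : ∃ k, k ∈ S := ⟨_, K, D, id, hid, hD, hDP, rfl⟩
  obtain ⟨G, p, i, hi, hp, hpP, hcard⟩ := Nat.find_spec hex
  obtain ⟨c, hc⟩ := assignments_nonempty hP hQ hfac hK hi hp hpP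
  obtain ⟨G', p', i', hi', rfl, hp', hpP', hx⟩ :=
    exists_extension hP hQ hfac hK hmin hpos hi hp hc X fun l => (hX l).1
  -- The extension does not itself ensure that `c` remains an assignment for `G'`; minimality of the
  -- number of assignments does.
  have heq := Set.eq_of_subset_of_ncard_le (assignments_subset_of_isEmb Q p' hi')
    (hcard ▸ Nat.find_min' hex ⟨G', p', i' ∘ i, hi'.comp hi, hp', hpP', rfl⟩)
  rw [← heq] at hc
  have hinj : Function.Injective c := by
    intro j j' hjj
    obtain ⟨x, hx, hxl⟩ := hx (c j')
    -- The parts of `p'` sent to one factor decompose a member of it containing a strict `X` of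
    -- number 1, so there is only one such part.
    let r : (G'.part (c ∘ p') (c j')).V → {k // c k = c j'} := fun v => ⟨p' v.1, v.2⟩
    have hr : Function.Surjective r := by
      rintro ⟨k, hk⟩
      obtain ⟨v, rfl⟩ := hp' k
      exact ⟨⟨v, hk⟩, rfl⟩
    have hle := card_le_decNumber (hQ (c j')) (hX (c j'))
      (hx.codRestrict (U := {v | c (p' v) = c j'}) hxl) hr
      ((blow_subset_of_refine (p := r) (r := fun v => p' v.1) fun u v h => Subtype.ext h).trans
        (hc (c j')))
    rw [hX1, Finite.card_le_one_iff_subsingleton] at hle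
    exact congrArg Subtype.val (hle.elim ⟨j, hjj⟩ ⟨j', rfl⟩)
  simpa using Fintype.card_le_of_injective c hinj

end DirHypergraph

theorem mainTheorem4 {C : Type*} (κ : MultiRule) (P : Set (DirHypergraph κ C))
    (hP : DirHypergraph.IsAdditiveInducedHereditary P) (m : ℕ) (Q : Fin m → Set (DirHypergraph κ C))
    (hQ : ∀ i, DirHypergraph.IsAdditiveInducedHereditary (Q i))
    (hQind : ∀ i, DirHypergraph.IsIndecomposable (Q i))
    (hfac : P = DirHypergraph.product Q) :
    (m : ℕ∞) = DirHypergraph.dec P := by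
  choose X hX hX1 using fun l => DirHypergraph.exists_decNumber_eq_one (hQind l)
  apply le_antisymm
  · refine le_iInf₂ fun G hG => ?_
    exact_mod_cast DirHypergraph.le_decNumber hP hQ hfac (fun l => ⟨X l, (hX l).1,
      DirHypergraph.nonempty_of_decNumber_eq_one (hX l).1 (hX1 l)⟩) hG
  · obtain ⟨K, hK, hle⟩ := DirHypergraph.exists_strict_decNumber_le hP hQ hfac X hX hX1
    exact (iInf₂_le K hK).trans (by exact_mod_cast hle)
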